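/- Let $d\ge 1$ and $p\ge 1$ be integers, $h>0$ and $\beta\ge 0$. Let $\mathcal S=(S(n))_{n\ge 0}$ be the nearest-neighbor random walk on $\mathbb Z^d$ with start at the origin and drift $h$ in the direction of the first axis, defined on a probability space $(\Omega,\mathcal F,P_h)$. That is, for every $n$, the law of $(S(0),\dots,S(n))$ under $P_h$ has density $\exp(hS_1(n))/E_0[\exp(hS_1(n))]$ with respect to the uniform distribution $P_0$ on the $n$-step nearest-neighbor paths started at the origin, where $S_1$ denotes the first coordinate of $S$. Let $\varphi:[0,\infty)\to[0,\infty)$ be nonconstant, concave and increasing, with $\lim_{t\to 0}\varphi(t)=\varphi(0)=0$ and $\lim_{t\to\infty}\varphi(t)=\infty$, and put $$\Phi_\beta(N)=\sum_{x\in\mathbb Z^d}\varphi\bigl(\beta\,\ell_x(N)\bigr),\qquad \ell_x(N)=\#\{1\le n\le N: S(n)=x\}.$$ Let $\mathcal S^1,\dots,\mathcal S^p$ be independent copies of $\mathcal S$, defined on the product space $\Omega^p$ with the product measure (again denoted $P_h$), with potentials $\Phi^1_\beta,\dots,\Phi^p_\beta$, and set $\Phi^{(p)}_\beta(N)=\sum_{j=1}^p\Phi^j_\beta(N^j)$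 for $N=(N^1,\dots,N^p)\in\mathbb N_0^p$. For $M,N\in\mathbb N_0^p$ with $M\le N$ componentwise, $\mathcal S^{(p)}[M,N]$ is called a *bridge* if $$S^1_1(M^1)=S^j_1(M^j)<S^j_1(n^j)\le S^j_1(N^j)=S^1_1(N^1)\qquad\text{for all } j=1,\dots,p \text{ and } M^j<n^j\le N^j$$ (the two equalities being required also when $M^j=N^j$); its *span* is $S^1_1(N^1)-S^1_1(M^1)$. If $M^j<N^j$ for all $j$, an integer $R$ with $S^1_1(M^1)<R\le S^1_1(N^1)$ is a *breaking point* of the bridge $\mathcal S^{(p)}[M,N]$ if there is $n\in\mathbb N^p$ with $M^j<n^j\le N^j$ for all $j$ such that $\mathcal S^{(p)}[M,n]$ is a bridge of span $R-S^1_1(M^1)$ and $\mathcal S^{(p)}[n,N]$ is a bridge of span $S^1_1(N^1)-R$. The bridge is *irreducible* if $S^1_1(N^1)$ is its only breaking point. For $L\in\mathbb N$ let $$\overline B^p_{h,\beta}(L)=\sum_{N\in\mathbb N_0^p}E_h\bigl[e^{-\Phi^{(p)}_\beta(N)};\ \mathcal S^{(p)}[0,N]\text{ is a bridge of span }L\bigr],$$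 $$\overline\Lambda^p_{h,\beta}(L)=\sum_{N\in\mathbb N^p}E_h\bigl[e^{-\Phi^{(p)}_\beta(N)};\ \mathcal S^{(p)}[0,N]\text{ is an irreducible bridge of span }L\bigr].$$ Then $\overline B^p_{h,\beta}(L)$ and $\overline\Lambda^p_{h,\beta}(L)$ lie in $(0,\infty)$ for every $L\in\mathbb N$, the limits $$\overline m^p_B(h,\beta)=\lim_{L\to\infty}\frac{-\log\overline B^p_{h,\beta}(L)}{L},\qquad \overline m^p_\Lambda(h,\beta)=\lim_{L\to\infty}\frac{-\log\overline\Lambda^p_{h,\beta}(L)}{L}$$ exist in $\mathbb R$, and $$\overline m^p_\Lambda(h,\beta)>\overline m^p_B(h,\beta).$$ -/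

import Mathlib

open Filter Topology MeasureTheory
open scoped ENNReal

noncomputable section

namespace DriftWalk

/-! ### The nearest-neighbour walk with drift -/

/-- The probability that the nondrifting (`h = 0`) walk follows the `n`-step path `x`: it is
`(1 / 2d) ^ n` for nearest-neighbour paths that start at the origin, and zero for other paths. -/
def srwPathProb {d : ℕ} (n : ℕ) (x : Fin (n + 1) → Fin d → ℤ) : ℝ :=
  open Classical in
  if x 0 = 0 ∧ ∀ i : Fin n, ∑ k : Fin d, |x i.succ k - x i.castSucc k| = 1
  then (1 / (2 * (d : ℝ))) ^ n else 0

/-- `E_0[exp (h * S_1(n))]`, the expectation taken under the nondrifting walk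
(only finitely many paths contribute). The first coordinate has index `0`. -/
def driftNormalization (d : ℕ) [NeZero d] (h : ℝ) (n : ℕ) : ℝ :=
  ∑' y : Fin (n + 1) → Fin d → ℤ, srwPathProb n y * Real.exp (h * (y (Fin.last n) 0 : ℝ))

/-- `S` is, under `P`, a nearest-neighbour random walk on `ℤ^d` with start at the origin and
drift `h` in the direction of the first axis: the law of `(S(0), …, S(n))` has density
`exp (h * S_1(n)) / E_0[exp (h * S_1(n))]` with respect to that of the nondrifting walk. -/
structure IsDriftedWalk {d : ℕ} [NeZero d] {Ω : Type*} [MeasurableSpace Ω]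
    (P : Measure Ω) (h : ℝ) (S : ℕ → Ω → Fin d → ℤ) : Prop where
  measurable : ∀ n, Measurable (S n)
  law : ∀ (n : ℕ) (x : Fin (n + 1) → Fin d → ℤ),
    P.real {ω | ∀ i : Fin (n + 1), S i ω = x i} =
      srwPathProb n x * Real.exp (h * (x (Fin.last n) 0 : ℝ)) / driftNormalization d h n

/-! ### The path potential -/

/-- The assumptions on the function `φ : [0, ∞) → [0, ∞)` (values at negative arguments are
irrelevant). It is nonnegative and nonconstant as a consequence of the fields. -/
structure IsPotentialFunction (φ : ℝ → ℝ) : Prop where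
  concave : ConcaveOn ℝ (Set.Ici 0) φ
  mono : MonotoneOn φ (Set.Ici 0)
  zero : φ 0 = 0
  tendsto_zero : Tendsto φ (𝓝[>] 0) (𝓝 0)
  tendsto_top : Tendsto φ atTop atTop

/-- The number of visits of the trajectory `X` to the site `x` at the times `1, …, N`. -/
def localTime {d : ℕ} (X : ℕ → Fin d → ℤ) (N : ℕ) (x : Fin d → ℤ) : ℕ :=
  ((Finset.Icc 1 N).filter fun n => X n = x).card

/-- The path potential `Φ_β(N) = ∑_x φ_β(ℓ_x(N))`, where `φ_β(t) = φ(tβ)`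
(only the finitely many visited sites contribute, as `φ 0 = 0`). -/
def pathPotential {d : ℕ} (φ : ℝ → ℝ) (β : ℝ) (X : ℕ → Fin d → ℤ) (N : ℕ) : ℝ :=
  ∑' x : Fin d → ℤ, φ ((localTime X N x : ℝ) * β)

/-- The path potential of a `p`-tuple of trajectories: `∑_j Φ_β^j(N^j)`. -/
def pathPotentialTuple {d p : ℕ} (φ : ℝ → ℝ) (β : ℝ) (X : Fin p → ℕ → Fin d → ℤ)
    (N : Fin p → ℕ) : ℝ :=
  ∑ j : Fin p, pathPotential φ β (X j) (N j)

/-! ### Bridges, breaking points, irreducible bridges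

Here `X j n` is the position of the `j`-th trajectory at time `n`; the first trajectory and the
first coordinate have index `0`. -/

section Paths

variable {d p : ℕ} [NeZero d] [NeZero p]

/-- The finite `p`-tuple of paths `X[M, N]` is a bridge. -/
def IsBridge (X : Fin p → ℕ → Fin d → ℤ) (M N : Fin p → ℕ) : Prop :=
  M ≤ N ∧ ∀ j : Fin p,
    X j (M j) 0 = X 0 (M 0) 0 ∧ X j (N j) 0 = X 0 (N 0) 0 ∧
      ∀ n : ℕ, M j < n → n ≤ N j → X j (M j) 0 < X j n 0 ∧ X j n 0 ≤ X j (N j) 0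

/-- The (integer) difference of the first coordinates of endpoint and starting point. -/
def span (X : Fin p → ℕ → Fin d → ℤ) (M N : Fin p → ℕ) : ℤ :=
  X 0 (N 0) 0 - X 0 (M 0) 0

/-- The integer `R` is a breaking point of `X[M, N]`. -/
def IsBreakingPoint (X : Fin p → ℕ → Fin d → ℤ) (M N : Fin p → ℕ) (R : ℤ) : Prop :=
  X 0 (M 0) 0 < R ∧ R ≤ X 0 (N 0) 0 ∧
    ∃ n : Fin p → ℕ, (∀ j, M j < n j) ∧ n ≤ N ∧
      (IsBridge X M n ∧ span X M n = R - X 0 (M 0) 0) ∧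
      (IsBridge X n N ∧ span X n N = X 0 (N 0) 0 - R)

/-- `X[M, N]` is an irreducible bridge: a bridge, with `M < N` in every component, whose endpoint
level is its only breaking point. -/
def IsIrreducibleBridge (X : Fin p → ℕ → Fin d → ℤ) (M N : Fin p → ℕ) : Prop :=
  (∀ j, M j < N j) ∧ IsBridge X M N ∧
    ∀ R : ℤ, IsBreakingPoint X M N R ↔ R = X 0 (N 0) 0

end Paths

/-! ### Weighted bridges and their masses

The `p` independent copies of the walk live on the product space `Fin p → Ω` with the product
measure; the `j`-th copy at time `n` is `S n (ω j)`. -/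

section Masses

variable {d : ℕ} [NeZero d] {Ω : Type*} [MeasurableSpace Ω]

/-- The trajectories of the `p` copies. -/
def copies (p : ℕ) (S : ℕ → Ω → Fin d → ℤ) (ω : Fin p → Ω) : Fin p → ℕ → Fin d → ℤ :=
  fun j n => S n (ω j)

/-- `E[exp (-Φ_β(N)); A(N)]` for a set `A(N)` of `p`-tuples of trajectories. -/
def weight (p : ℕ) (P : Measure Ω) [IsProbabilityMeasure P] (S : ℕ → Ω → Fin d → ℤ)
    (φ : ℝ → ℝ) (β : ℝ) (N : Fin p → ℕ) (A : Set (Fin p → ℕ → Fin d → ℤ)) : ℝ≥0∞ :=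
  ∫⁻ ω in {ω | copies p S ω ∈ A},
    ENNReal.ofReal (Real.exp (-pathPotentialTuple φ β (copies p S ω) N))
    ∂(Measure.pi fun _ : Fin p => P)

/-- `B^p(L)`: the total weight of bridges of span `L` started at time `0`. -/
def bridgeWeight (p : ℕ) [NeZero p] (P : Measure Ω) [IsProbabilityMeasure P]
    (S : ℕ → Ω → Fin d → ℤ) (φ : ℝ → ℝ) (β : ℝ) (L : ℕ) : ℝ≥0∞ :=
  ∑' N : Fin p → ℕ, weight p P S φ β N {X | IsBridge X 0 N ∧ span X 0 N = L}

/-- `Λ^p(L)`: the total weight of irreducible bridges of span `L` started at time `0`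
(only the `N` with all components positive contribute). -/
def irreducibleBridgeWeight (p : ℕ) [NeZero p] (P : Measure Ω) [IsProbabilityMeasure P]
    (S : ℕ → Ω → Fin d → ℤ) (φ : ℝ → ℝ) (β : ℝ) (L : ℕ) : ℝ≥0∞ :=
  ∑' N : Fin p → ℕ, weight p P S φ β N {X | IsIrreducibleBridge X 0 N ∧ span X 0 N = L}

/-- The exponential decay rate `-log a(L) / L` at length `L`. -/
def rate (a : ℕ → ℝ≥0∞) (L : ℕ) : ℝ := -Real.log (a L).toReal / L

/-- The mass `lim_{L → ∞} -log a(L) / L` of the sequence `a`. -/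
def mass (a : ℕ → ℝ≥0∞) : ℝ := limUnder atTop (rate a)

end Masses

end DriftWalk

end

/-!
The proof replaces the walk by sums over words of steps. A `p`-tuple of words has the weight
`∏ exp (h * height) * Z ^ (-length) * exp (-Φ)`, where `Z` is the normalizing constant of one
step, and `bridgeWeight`, `irreducibleBridgeWeight` are the sums `B L`, `Λ L` of these weights over
the tuples of words that are (irreducible) bridges of span `L` (`bridgeWeight_eq_bridgeSum`,
`irreducibleBridgeWeight_eq_irreducibleSum`).

Two properties of the potential are used. It is subadditive under concatenation, since `φ` is
concave; and if the last part of a path visits no site of its first part, the potential of the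
whole is at least the sum of the potentials of these two parts, since `φ` is monotone. Hence:

* concatenation gives `B m * B n ≤ B (m + n)`, and joining irreducible bridges by a detour
  `up, down`, which destroys the breaking level at the joint, gives `c * Λ m * Λ n ≤ Λ (m + n)`.
  Fekete's lemma then yields both decay rates;
* a bridge of span `m + n` can be cut at its first and its last visits to the level `m`. The
  pieces in between return to their starting level; because of the drift, `Z` exceeds the number of
  steps, so that the weights of such pieces have exponential moments in the length
  (`exists_exponential_moment`). Hence `B (m + n) ≤ G * B m * B n`, and `B n` equals `exp (-μ n)` up
  to constant factors.

The second fact and the renewal inequality `∑ k, Λ k * B (L - k) ≤ B L` show that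
`λ k = Λ k * exp (μ k)` is summable. Finally an irreducible bridge is cut in the same way: if the
pieces in between have total length `s`, they can only destroy breaking levels within distance `s`
of the cut, so the two outer bridges have no other breaking levels. Decomposing these at their
first, respectively last, breaking level bounds the tails `T n = ∑ k ≥ n, λ k` by
`T (m + n) ≤ ∑ q * (s + 1) * T (m - s) * T (n - s)` (`tail_add_le`), the sum being over the
pieces in between, with weights `q`. As `T n → 0`, a block of large length contributes a
factor at most `1 / 2`, and `T` decays exponentially (`exists_exponential_decay`). This is the gap
between the two rates.
-/

noncomputable section

open scoped NNReal

namespace DriftWalk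

/-! ### The potential of a list of sites -/

section SitePotential

variable {α : Type*} [DecidableEq α]

/-- The potential of a finite list of visited sites, `∑_x φ (β * #visits to x)`. -/
def sitePotential (φ : ℝ → ℝ) (β : ℝ) (l : List α) : ℝ :=
  ∑' x : α, φ ((l.count x : ℝ) * β)

variable {φ : ℝ → ℝ} {β : ℝ}

lemma sitePotential_eq_sum (hφ : IsPotentialFunction φ) (l : List α) {s : Finset α}
    (hs : ∀ x ∈ l, x ∈ s) : sitePotential φ β l = ∑ x ∈ s, φ ((l.count x : ℝ) * β) := by
  refine tsum_eq_sum fun x hx => ?_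
  have : l.count x = 0 := List.count_eq_zero.2 fun h => hx (hs x h)
  simp [this, hφ.zero]

lemma IsPotentialFunction.nonneg (hφ : IsPotentialFunction φ) {t : ℝ} (ht : 0 ≤ t) : 0 ≤ φ t := by
  have := hφ.mono (Set.mem_Ici.2 le_rfl) (Set.mem_Ici.2 ht) ht
  rwa [hφ.zero] at this

/-- A concave function vanishing at `0` is subadditive. -/
lemma IsPotentialFunction.add_le (hφ : IsPotentialFunction φ) {s t : ℝ} (hs : 0 ≤ s)
    (ht : 0 ≤ t) : φ (s + t) ≤ φ s + φ t := by
  rcases eq_or_lt_of_le (add_nonneg hs ht) with h0 | hpos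
  · have h1 : s = 0 := by linarith
    have h2 : t = 0 := by linarith
    simp [h1, h2, hφ.zero]
  -- each of `s`, `t` is a convex combination of `0` and `s + t`
  have key : ∀ r : ℝ, 0 ≤ r → r ≤ s + t → r / (s + t) * φ (s + t) ≤ φ r := by
    intro r hr hrs
    have hw : 0 ≤ 1 - r / (s + t) := by
      rw [sub_nonneg, div_le_one hpos]; exact hrs
    have := hφ.concave.2 (x := 0) (y := s + t) (Set.mem_Ici.2 le_rfl) (Set.mem_Ici.2 hpos.le)
      hw (div_nonneg hr hpos.le) (by ring)
    simp only [smul_eq_mul, hφ.zero, mul_zero, zero_add] at this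
    rwa [div_mul_cancel₀ _ hpos.ne'] at this
  have h1 := key s hs (by linarith)
  have h2 := key t ht (by linarith)
  have : s / (s + t) * φ (s + t) + t / (s + t) * φ (s + t) = φ (s + t) := by
    field_simp
  linarith

lemma sitePotential_nonneg (hφ : IsPotentialFunction φ) (hβ : 0 ≤ β) (l : List α) :
    0 ≤ sitePotential φ β l :=
  tsum_nonneg fun _ => hφ.nonneg (by positivity)

lemma sitePotential_append_le (hφ : IsPotentialFunction φ) (hβ : 0 ≤ β) (l l' : List α) :
    sitePotential φ β (l ++ l') ≤ sitePotential φ β l + sitePotential φ β l' := by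
  have hs : ∀ x ∈ l ++ l', x ∈ (l ++ l').toFinset := by simp
  rw [sitePotential_eq_sum hφ _ hs,
    sitePotential_eq_sum hφ l fun x hx => hs x (List.mem_append_left _ hx),
    sitePotential_eq_sum hφ l' fun x hx => hs x (List.mem_append_right _ hx),
    ← Finset.sum_add_distrib]
  refine Finset.sum_le_sum fun x _ => ?_
  rw [List.count_append, Nat.cast_add, add_mul]
  exact hφ.add_le (by positivity) (by positivity)

/-- If the sites of `l` and `l''` are disjoint, their potentials add up, and the visits of an
intermediate piece `l'` can only increase the total. -/
lemma add_le_sitePotential_append (hφ : IsPotentialFunction φ) (hβ : 0 ≤ β) (l l' l'' : List α)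
    (hdisj : l.Disjoint l'') :
    sitePotential φ β l + sitePotential φ β l'' ≤ sitePotential φ β (l ++ l' ++ l'') := by
  have hs : ∀ x ∈ l ++ l' ++ l'', x ∈ (l ++ l' ++ l'').toFinset := fun x hx =>
    List.mem_toFinset.2 hx
  rw [sitePotential_eq_sum hφ _ hs, sitePotential_eq_sum hφ l fun x hx => hs x (by simp [hx]),
    sitePotential_eq_sum hφ l'' fun x hx => hs x (by simp [hx]), ← Finset.sum_add_distrib]
  refine Finset.sum_le_sum fun x _ => ?_
  have hm : ∀ m n : ℕ, m ≤ n → φ ((m : ℝ) * β) ≤ φ ((n : ℝ) * β) := fun m n hmn =>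
    hφ.mono (Set.mem_Ici.2 (by positivity)) (Set.mem_Ici.2 (by positivity)) (by gcongr)
  by_cases hx : x ∈ l
  · have h0 : l''.count x = 0 := List.count_eq_zero.2 (hdisj hx)
    rw [h0, Nat.cast_zero, zero_mul, hφ.zero, add_zero]
    exact hm _ _ (by simp only [List.count_append]; omega)
  · have h0 : l.count x = 0 := List.count_eq_zero.2 hx
    rw [h0, Nat.cast_zero, zero_mul, hφ.zero, zero_add]
    exact hm _ _ (by simp only [List.count_append]; omega)

lemma sitePotential_map_equiv {γ : Type*} [DecidableEq γ] (e : α ≃ γ) (l : List α) :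
    sitePotential φ β (l.map e) = sitePotential φ β l := by
  unfold sitePotential
  rw [← e.tsum_eq]
  simp only [List.count_map_of_injective l e e.injective]

end SitePotential

/-! ### Nearest-neighbour paths as words of steps -/

/-- The steps of a nearest-neighbour path on `ℤ^d`. A path started at the origin is encoded as the
list of its steps, so that concatenation of paths is `++`. -/
abbrev Step (d : ℕ) : Type := {v : Fin d → ℤ // ∑ k, |v k| = 1}

section Words

variable {d : ℕ}

instance : Finite (Step d) := by
  refine Set.Finite.subset (Set.finite_Icc (-1 : Fin d → ℤ) 1) fun v hv => ?_
  have hk : ∀ k, |v k| ≤ 1 := fun k =>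
    (Finset.single_le_sum (f := fun k => |v k|) (fun _ _ => abs_nonneg _)
      (Finset.mem_univ k)).trans_eq hv
  exact ⟨fun k => (abs_le.1 (hk k)).1, fun k => (abs_le.1 (hk k)).2⟩

instance : Fintype (Step d) := Fintype.ofFinite _

/-- The endpoint of the path with the given steps. -/
def disp (w : List (Step d)) : Fin d → ℤ := (w.map Subtype.val).sum

@[simp] lemma disp_nil : disp ([] : List (Step d)) = 0 := rfl

@[simp] lemma disp_cons (s : Step d) (w : List (Step d)) : disp (s :: w) = s.1 + disp w := by
  simp [disp]

@[simp] lemma disp_append (u v : List (Step d)) : disp (u ++ v) = disp u + disp v := by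
  simp [disp]

/-- The sites visited by the path at the times `1, …, w.length`. -/
def sites : List (Step d) → List (Fin d → ℤ)
  | [] => []
  | s :: w => s.1 :: (sites w).map (s.1 + ·)

lemma sites_append (u v : List (Step d)) :
    sites (u ++ v) = sites u ++ (sites v).map (disp u + ·) := by
  induction u with
  | nil => simp [sites]
  | cons s u ih => simp [sites, ih, Function.comp_def, add_assoc]

lemma sitePotential_map_add {φ : ℝ → ℝ} {β : ℝ} (a : Fin d → ℤ) (l : List (Fin d → ℤ)) :
    sitePotential φ β (l.map (a + ·)) = sitePotential φ β l :=
  sitePotential_map_equiv (Equiv.addLeft a) l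

lemma exists_of_mem_sites {w : List (Step d)} {x : Fin d → ℤ} (hx : x ∈ sites w) :
    ∃ a b, w = a ++ b ∧ a ≠ [] ∧ disp a = x := by
  induction w generalizing x with
  | nil => simp [sites] at hx
  | cons s w ih =>
    rcases List.mem_cons.1 hx with rfl | hx
    · exact ⟨[s], w, rfl, by simp, by simp⟩
    · obtain ⟨y, hy, rfl⟩ := List.mem_map.1 hx
      obtain ⟨a, b, rfl, -, rfl⟩ := ih hy
      exact ⟨s :: a, b, rfl, by simp, by simp⟩

variable [NeZero d]

/-- The first coordinate of the endpoint. -/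
def ht (w : List (Step d)) : ℤ := disp w 0

@[simp] lemma ht_nil : ht ([] : List (Step d)) = 0 := rfl

@[simp] lemma ht_cons (s : Step d) (w : List (Step d)) : ht (s :: w) = s.1 0 + ht w := by
  simp [ht]

@[simp] lemma ht_append (u v : List (Step d)) : ht (u ++ v) = ht u + ht v := by
  simp [ht]

lemma Step.abs_le_one (s : Step d) : |s.1 0| ≤ 1 :=
  (Finset.single_le_sum (f := fun k => |s.1 k|) (fun _ _ => abs_nonneg _)
    (Finset.mem_univ 0)).trans_eq s.2

lemma abs_ht_le_length (w : List (Step d)) : |ht w| ≤ w.length := by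
  induction w with
  | nil => simp
  | cons s w ih =>
    rw [ht_cons, List.length_cons]
    have := abs_add_le (s.1 0) (ht w)
    have := s.abs_le_one
    push_cast
    linarith

/-- The step in direction of the drift. -/
def up : Step d := ⟨Pi.single 0 1, by
  rw [Finset.sum_eq_single 0] <;> simp +contextual⟩

/-- The step against the drift. -/
def down : Step d := ⟨Pi.single 0 (-1), by
  rw [Finset.sum_eq_single 0] <;> simp +contextual⟩

@[simp] lemma up_zero : (up : Step d).1 0 = 1 := by simp [up]

@[simp] lemma down_zero : (down : Step d).1 0 = -1 := by simp [down]

/-! ### Bridges and breaking levels of words -/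

/-- The path with steps `w` is a bridge: it stays strictly above its starting level after time
`0`, and its endpoint has maximal level. -/
def WordBridge (w : List (Step d)) : Prop :=
  ∀ a b, w = a ++ b → (a ≠ [] → 0 < ht a) ∧ 0 ≤ ht b

lemma WordBridge.ht_pos {w a b : List (Step d)} (hw : WordBridge w) (h : w = a ++ b)
    (ha : a ≠ []) : 0 < ht a := (hw a b h).1 ha

lemma WordBridge.ht_nonneg {w a b : List (Step d)} (hw : WordBridge w) (h : w = a ++ b) :
    0 ≤ ht b := (hw a b h).2

lemma wordBridge_nil : WordBridge ([] : List (Step d)) := by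
  intro a b h
  obtain ⟨rfl, rfl⟩ := List.append_eq_nil_iff.1 h.symm
  simp

lemma wordBridge_up : WordBridge [(up : Step d)] := by
  intro a b h
  rcases List.append_eq_singleton_iff.1 h.symm with ⟨rfl, rfl⟩ | ⟨rfl, rfl⟩ <;> simp

lemma WordBridge.append {u v : List (Step d)} (hu : WordBridge u) (hv : WordBridge v) :
    WordBridge (u ++ v) := by
  intro a b h
  have h0 : 0 ≤ ht u := hu.ht_nonneg (a := []) rfl
  have h1 : 0 ≤ ht v := hv.ht_nonneg (a := []) rfl
  rcases List.append_eq_append_iff.1 h with ⟨c, rfl, hc⟩ | ⟨c, rfl, hc⟩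
  · refine ⟨fun ha => ?_, hv.ht_nonneg hc⟩
    rw [ht_append]
    by_cases h2 : c = []
    · subst h2
      rw [List.append_nil] at ha
      have := hu.ht_pos (a := u) (b := []) (by simp) ha
      simpa using this
    · have := hv.ht_pos hc h2
      omega
  · refine ⟨fun ha => hu.ht_pos rfl ha, ?_⟩
    rw [hc, ht_append]
    have := hu.ht_nonneg (a := a) (b := c) rfl
    omega

/-- `R` is a breaking level of `w`: the path is the concatenation of two bridges, the first one
of span `R`. -/
def BreaksAt (w : List (Step d)) (R : ℕ) : Prop :=
  ∃ a b, w = a ++ b ∧ WordBridge a ∧ WordBridge b ∧ ht a = R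

/-- A concatenation of two bridges can be recovered from the span of the first one. -/
lemma WordBridge.append_inj {u v u' v' : List (Step d)} (hu : ht u = ht u')
    (hv : WordBridge v) (hv' : WordBridge v') (h : u ++ v = u' ++ v') : u = u' ∧ v = v' := by
  rcases List.append_eq_append_iff.1 h with ⟨c, rfl, hc⟩ | ⟨c, rfl, hc⟩
  · by_cases h2 : c = []
    · subst h2; simpa using hc
    · have := hv.ht_pos hc h2
      simp at hu; omega
  · by_cases h2 : c = []
    · subst h2; simpa using hc.symm
    · have := hv'.ht_pos hc h2
      simp at hu; omega

end Words

/-! ### Cutting a bridge at a level -/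

section Cutting

variable {d : ℕ} [NeZero d]

/-- Cutting a path at the first visit to the level `L`. -/
lemma exists_first_visit (w : List (Step d)) (L : ℤ) (hL : 0 ≤ L) (hw : L ≤ ht w) :
    ∃ u r, w = u ++ r ∧ ht u = L ∧ ∀ a b, u = a ++ b → b ≠ [] → ht a < L := by
  induction w generalizing L with
  | nil => exact ⟨[], [], rfl, by simp at hw ⊢; omega, by simp +contextual⟩
  | cons s w ih =>
    rcases hL.eq_or_lt with rfl | hL'
    · exact ⟨[], s :: w, rfl, rfl, by simp +contextual⟩
    · have hs := abs_le.1 s.abs_le_one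
      rw [ht_cons] at hw
      obtain ⟨u, r, rfl, hu, hlt⟩ := ih (L - s.1 0) (by omega) (by omega)
      refine ⟨s :: u, r, rfl, by rw [ht_cons]; omega, fun a b hab hb => ?_⟩
      rcases List.cons_eq_append_iff.1 hab with ⟨rfl, -⟩ | ⟨a', rfl, h'⟩
      · simpa using hL'
      · have := hlt a' b h' hb
        rw [ht_cons]; omega

/-- Cutting a path at the last visit to its starting level. -/
lemma exists_last_visit (w : List (Step d)) (hw : 0 ≤ ht w) :
    ∃ m v, w = m ++ v ∧ ht m = 0 ∧ ∀ a b, v = a ++ b → a ≠ [] → 0 < ht a := by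
  induction w using List.reverseRecOn with
  | nil => exact ⟨[], [], rfl, rfl, by simp +contextual⟩
  | append_singleton w s ih =>
    rcases hw.eq_or_lt with h0 | hpos
    · exact ⟨w ++ [s], [], by simp, h0.symm, by simp +contextual⟩
    · have hs := abs_le.1 s.abs_le_one
      have h1 : ht (w ++ [s]) = ht w + s.1 0 := by simp
      obtain ⟨m, v, rfl, hm, hv⟩ := ih (by omega)
      refine ⟨m, v ++ [s], by simp, hm, fun a b hab ha => ?_⟩
      rcases List.append_eq_append_iff.1 hab with ⟨c, rfl, hc⟩ | ⟨c, rfl, hc⟩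
      · rcases List.append_eq_singleton_iff.1 hc.symm with ⟨rfl, -⟩ | ⟨rfl, -⟩
        · simpa using hv v [] (by simp) (by simpa using ha)
        · simp only [ht_append, hm, ht_cons, ht_nil] at hpos ⊢
          omega
      · exact hv a c rfl ha

/-- A bridge of span `L₁ + L₂` splits at its first and its last visit to the level `L₁`: into a
bridge of span `L₁`, a piece that starts and ends at the same level, and a bridge of span `L₂`. -/
lemma WordBridge.exists_cut {w : List (Step d)} (hw : WordBridge w) {L₁ L₂ : ℕ}
    (hL : ht w = (L₁ + L₂ : ℕ)) :
    ∃ u m v, w = u ++ m ++ v ∧ WordBridge u ∧ ht u = L₁ ∧ ht m = 0 ∧ WordBridge v ∧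
      ht v = L₂ := by
  obtain ⟨u, r, rfl, hu, hfirst⟩ := exists_first_visit w L₁ (by positivity) (by omega)
  rw [ht_append] at hL
  obtain ⟨m, v, rfl, hm, hlast⟩ := exists_last_visit r (by omega)
  rw [ht_append] at hL
  refine ⟨u, m, v, by simp, fun a b hab => ⟨fun ha => ?_, ?_⟩, hu, hm, fun a b hab =>
    ⟨hlast a b hab, ?_⟩, by omega⟩
  · exact hw.ht_pos (b := b ++ (m ++ v)) (by simp [hab]) ha
  · by_cases hb : b = []
    · simp [hb]
    · have := hfirst a b hab hb
      rw [hab, ht_append] at hu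
      omega
  · exact hw.ht_nonneg (a := u ++ (m ++ a)) (by simp [hab])

/-- A breaking level of the first part that is too low to be reached by the middle part is a
breaking level of the whole. -/
lemma BreaksAt.of_left {u m v : List (Step d)} (hw : WordBridge (u ++ m ++ v)) (hm : ht m = 0)
    (hv : WordBridge v) {R : ℕ} (hR : BreaksAt u R) (hlt : R + (m.length : ℤ) < ht u) :
    BreaksAt (u ++ m ++ v) R := by
  obtain ⟨a, b, rfl, ha, hb, hab⟩ := hR
  refine ⟨a, b ++ (m ++ v), by simp, ha, fun x y hxy => ⟨fun hx => ?_, ?_⟩, hab⟩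
  · have hbm : (m.length : ℤ) < ht b := by rw [ht_append] at hlt; omega
    rcases List.append_eq_append_iff.1 hxy with ⟨c, rfl, hc⟩ | ⟨c, rfl, hc⟩
    · rcases List.append_eq_append_iff.1 hc with ⟨e, rfl, he⟩ | ⟨e, rfl, he⟩
      · have : 0 ≤ ht e := by
          by_cases h0 : e = []
          · simp [h0]
          · exact (hv.ht_pos he h0).le
        simp only [ht_append, hm]
        omega
      · have := abs_le.1 (abs_ht_le_length c)
        simp only [List.length_append, Nat.cast_add] at hbm
        simp only [ht_append]
        omega
    · exact hb.ht_pos rfl hx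
  · exact hw.ht_nonneg (a := a ++ x) (by simp [hxy])

/-- A breaking level of the last part that is too high to be reached by the middle part gives a
breaking level of the whole. -/
lemma BreaksAt.of_right {u m v : List (Step d)} (hw : WordBridge (u ++ m ++ v)) (hm : ht m = 0)
    (hu : WordBridge u) {L R : ℕ} (hL : ht u = L) (hR : BreaksAt v R) (hlt : m.length < R) :
    BreaksAt (u ++ m ++ v) (L + R) := by
  obtain ⟨a, b, rfl, ha, hb, hab⟩ := hR
  refine ⟨u ++ m ++ a, b, by simp, fun x y hxy => ⟨fun hx => ?_, ?_⟩, hb, by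
    simp [hm, hab, hL]⟩
  · exact hw.ht_pos (b := y ++ b) (by rw [← List.append_assoc x, ← hxy]; simp) hx
  · rcases List.append_eq_append_iff.1 hxy with ⟨c, rfl, hc⟩ | ⟨c, h1, rfl⟩
    · exact ha.ht_nonneg hc
    · rcases List.append_eq_append_iff.1 h1 with ⟨e, rfl, rfl⟩ | ⟨e, rfl, rfl⟩
      · have := abs_le.1 (abs_ht_le_length c)
        simp only [List.length_append] at hlt
        simp only [ht_append]
        omega
      · have : 0 ≤ ht e := hu.ht_nonneg rfl
        simp only [ht_append, hm]
        omega

end Cutting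

/-! ### Tuples of words -/

section Tuples

variable {d p : ℕ} [NeZero d]

/-- All words of the tuple are bridges of span `L`. -/
def TupleBridge (L : ℕ) (w : Fin p → List (Step d)) : Prop :=
  ∀ j, WordBridge (w j) ∧ ht (w j) = L

/-- The tuple is a bridge of span `L > 0` and no level in `(0, L)` is a breaking level common to
all its words. -/
def TupleIrreducible (L : ℕ) (w : Fin p → List (Step d)) : Prop :=
  0 < L ∧ TupleBridge L w ∧ ∀ R, 0 < R → R < L → ¬ ∀ j, BreaksAt (w j) R

lemma TupleBridge.append {L L' : ℕ} {u v : Fin p → List (Step d)} (hu : TupleBridge L u)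
    (hv : TupleBridge L' v) : TupleBridge (L + L') fun j => u j ++ v j := fun j =>
  ⟨(hu j).1.append (hv j).1, by simp [(hu j).2, (hv j).2]⟩

lemma BreaksAt.append {u v : List (Step d)} {R : ℕ} (hu : BreaksAt u R) (hv : WordBridge v) :
    BreaksAt (u ++ v) R := by
  obtain ⟨a, b, rfl, ha, hb, hab⟩ := hu
  exact ⟨a, b ++ v, by simp, ha, hb.append hv, hab⟩

lemma BreaksAt.append_left {u v : List (Step d)} {L R : ℕ} (hv : BreaksAt v R)
    (hu : WordBridge u) (hL : ht u = L) : BreaksAt (u ++ v) (L + R) := by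
  obtain ⟨a, b, rfl, ha, hb, hab⟩ := hv
  exact ⟨u ++ a, b, by simp, hu.append ha, hb, by simp [hL, hab]⟩

/-- Splitting a bridge at its first common breaking level, which is at least `r` if none lies
in `(0, r)`. -/
lemma TupleBridge.exists_first_break {L r : ℕ} (hL : 0 < L)
    {w : Fin p → List (Step d)} (hw : TupleBridge L w)
    (hbr : ∀ R, 0 < R → R < r → ¬ ∀ j, BreaksAt (w j) R) :
    ∃ i, r ≤ i ∧ i ≤ L ∧ ∃ a b : Fin p → List (Step d), (∀ j, w j = a j ++ b j) ∧
      TupleIrreducible i a ∧ TupleBridge (L - i) b := by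
  classical
  have hex : ∃ R, 0 < R ∧ ∀ j, BreaksAt (w j) R :=
    ⟨L, hL, fun j => ⟨w j, [], by simp, (hw j).1, wordBridge_nil, (hw j).2⟩⟩
  obtain ⟨h0, hspec⟩ := Nat.find_spec hex
  have hmin := fun R => Nat.find_min (H := hex) (m := R)
  have hle : Nat.find hex ≤ L := Nat.find_min' hex
    ⟨hL, fun j => ⟨w j, [], by simp, (hw j).1, wordBridge_nil, (hw j).2⟩⟩
  generalize Nat.find hex = i at *
  choose a b hab ha hb hi using hspec
  refine ⟨i, ?_, hle, a, b, hab, ⟨h0, fun j => ⟨ha j, hi j⟩, fun R hR hRi hall => ?_⟩,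
    fun j => ⟨hb j, ?_⟩⟩
  · by_contra! hlt
    exact hbr i h0 hlt fun j => ⟨a j, b j, hab j, ha j, hb j, hi j⟩
  · refine hmin R hRi ⟨hR, fun j => ?_⟩
    rw [hab]
    exact (hall j).append (hb j)
  · have := (hw j).2
    rw [hab, ht_append, hi] at this
    omega

/-- Splitting a bridge at its last common breaking level below the top, which is at most `r` if
none lies in `(r, L)`; it is `0` if there is no breaking level at all. -/
lemma TupleBridge.exists_last_break {L r : ℕ} (hL : 0 < L)
    {w : Fin p → List (Step d)} (hw : TupleBridge L w)
    (hbr : ∀ R, r < R → R < L → ¬ ∀ j, BreaksAt (w j) R) :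
    ∃ i, i ≤ r ∧ i < L ∧ ∃ a b : Fin p → List (Step d), (∀ j, w j = a j ++ b j) ∧
      TupleBridge i a ∧ TupleIrreducible (L - i) b := by
  classical
  -- `L - 1 - R` is minimal for the last breaking level `R`
  have hex : ∃ k, k < L ∧ ∀ j, BreaksAt (w j) (L - 1 - k) :=
    ⟨L - 1, by omega, fun j => ⟨[], w j, by simp, wordBridge_nil, (hw j).1, by simp⟩⟩
  obtain ⟨h0, hspec⟩ := Nat.find_spec hex
  have hmin := fun R => Nat.find_min (H := hex) (m := R)
  generalize Nat.find hex = k at *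
  obtain ⟨i, rfl⟩ : ∃ i, k = L - 1 - i := ⟨L - 1 - k, by omega⟩
  wlog hiL : i < L generalizing i with H
  · exact H (L - 1 - (L - 1 - i)) (by omega) (by
      rwa [show L - 1 - (L - 1 - (L - 1 - (L - 1 - i))) = L - 1 - (L - 1 - i) by omega])
      (fun R hR => hmin R (by omega)) (by omega)
  rw [show L - 1 - (L - 1 - i) = i by omega] at hspec
  choose a b hab ha hb hi using hspec
  refine ⟨i, ?_, hiL, a, b, hab, fun j => ⟨ha j, hi j⟩, by omega, fun j => ⟨hb j, ?_⟩,
    fun R hR hRi hall => hmin (L - 1 - (i + R)) (by omega) ⟨by omega, fun j => ?_⟩⟩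
  · by_contra! hlt
    exact hbr i hlt hiL fun j => ⟨a j, b j, hab j, ha j, hb j, hi j⟩
  · have := (hw j).2
    rw [hab, ht_append, hi] at this
    omega
  · rw [show L - 1 - (L - 1 - (i + R)) = i + R by omega, hab]
    exact (hall j).append_left (ha j) (hi j)

lemma TupleBridge.exists_cut {L₁ L₂ : ℕ} {w : Fin p → List (Step d)}
    (hw : TupleBridge (L₁ + L₂) w) :
    ∃ u m v : Fin p → List (Step d), (∀ j, w j = u j ++ m j ++ v j) ∧ TupleBridge L₁ u ∧
      (∀ j, ht (m j) = 0) ∧ TupleBridge L₂ v := by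
  choose u m v h1 h2 h3 h4 h5 h6 using fun j => (hw j).1.exists_cut (hw j).2
  exact ⟨u, m, v, h1, fun j => ⟨h2 j, h3 j⟩, h4, fun j => ⟨h5 j, h6 j⟩⟩

/-- Cutting an irreducible bridge of span `L₁ + L₂` at the level `L₁` leaves two bridges all of
whose breaking levels are within distance `n` of the cut, where `n` is the total length of the
pieces between the first and the last visits to the level `L₁`. -/
lemma TupleIrreducible.exists_cut {L₁ L₂ : ℕ} {w : Fin p → List (Step d)}
    (hw : TupleIrreducible (L₁ + L₂) w) :
    ∃ u m v : Fin p → List (Step d), (∀ j, w j = u j ++ m j ++ v j) ∧ TupleBridge L₁ u ∧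
      (∀ j, ht (m j) = 0) ∧ TupleBridge L₂ v ∧
      (∀ R, 0 < R → R < L₁ - ∑ j, (m j).length → ¬ ∀ j, BreaksAt (u j) R) ∧
      ∀ R, ∑ j, (m j).length < R → R < L₂ → ¬ ∀ j, BreaksAt (v j) R := by
  obtain ⟨u, m, v, h1, hu, hm, hv⟩ := hw.2.1.exists_cut
  have hlen : ∀ j, (m j).length ≤ ∑ j, (m j).length := fun j =>
    Finset.single_le_sum (f := fun j => (m j).length) (fun _ _ => Nat.zero_le _)
      (Finset.mem_univ j)
  have hwj : ∀ j, WordBridge (u j ++ m j ++ v j) := fun j => h1 j ▸ (hw.2.1 j).1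
  refine ⟨u, m, v, h1, hu, hm, hv, fun R hR hRL hall => ?_, fun R hR hRL hall => ?_⟩
  · refine hw.2.2 R hR (by omega) fun j => ?_
    rw [h1]
    refine BreaksAt.of_left (hwj j) (hm j) (hv j).1 (hall j) ?_
    rw [(hu j).2]
    have := hlen j
    omega
  · refine hw.2.2 (L₁ + R) (by omega) (by omega) fun j => ?_
    rw [h1]
    exact BreaksAt.of_right (hwj j) (hm j) (hu j).1 (hu j).2 (hall j) ((hlen j).trans_lt hR)

end Tuples

/-! ### Gluing irreducible bridges -/

section Gluing

variable {d p : ℕ} [NeZero d]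

lemma WordBridge.glue {u v : List (Step d)} (hu : WordBridge u) (hv : WordBridge v)
    (hu0 : 0 < ht u) (hv0 : 0 < ht v) : WordBridge (u ++ ([up, down] ++ v)) := by
  intro a b hab
  rcases List.append_eq_append_iff.1 hab with ⟨c, rfl, hc⟩ | ⟨c, rfl, rfl⟩
  · rcases List.append_eq_append_iff.1 hc with ⟨e, rfl, he⟩ | ⟨e, h1, rfl⟩
    · have h2 : 0 ≤ ht e := by
        by_cases h0 : e = []
        · simp [h0]
        · exact (hv.ht_pos he h0).le
      refine ⟨fun _ => ?_, hv.ht_nonneg he⟩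
      simp only [ht_append, ht_cons, up_zero, down_zero, ht_nil]
      omega
    · have h2 : 0 ≤ ht c ∧ ht c + ht e = 0 ∧ -1 ≤ ht e := by
        rcases List.cons_eq_append_iff.1 h1 with ⟨rfl, rfl⟩ | ⟨c', rfl, h2⟩
        · simp
        rcases List.cons_eq_append_iff.1 h2 with ⟨rfl, rfl⟩ | ⟨c'', rfl, h3⟩
        · simp
        obtain ⟨rfl, rfl⟩ := List.append_eq_nil_iff.1 h3.symm
        simp
      refine ⟨fun _ => by rw [ht_append]; omega, ?_⟩
      rw [ht_append]; omega
  · refine ⟨fun ha => hu.ht_pos rfl ha, ?_⟩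
    have : 0 ≤ ht c := hu.ht_nonneg rfl
    simp only [ht_append, ht_cons, up_zero, down_zero, ht_nil]
    omega

/-- The detour `up, down` between two bridges destroys the breaking level between them and creates
no new one. -/
lemma BreaksAt.of_glue {u v : List (Step d)} (hu : WordBridge u) (hv : WordBridge v) {L R : ℕ}
    (hL : ht u = L) (hR : BreaksAt (u ++ ([up, down] ++ v)) R) :
    (R < L ∧ BreaksAt u R) ∨ (L < R ∧ BreaksAt v (R - L)) := by
  obtain ⟨a, b, hab, ha, hb, hR⟩ := hR
  have hcase : (∃ c, a = u ++ c ∧ [up, down] ++ v = c ++ b) ∨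
      ∃ c, c ≠ [] ∧ u = a ++ c ∧ b = c ++ ([up, down] ++ v) := by
    rcases List.append_eq_append_iff.1 hab with ⟨c, h1, h2⟩ | ⟨c, h1, h2⟩
    · exact Or.inl ⟨c, h1, h2⟩
    · by_cases hc : c = []
      · exact Or.inl ⟨[], by simp [h1, hc], by simp [h2, hc]⟩
      · exact Or.inr ⟨c, hc, h1, h2⟩
  rcases hcase with ⟨c, rfl, hc⟩ | ⟨c, hc, rfl, rfl⟩
  · right
    rcases List.cons_eq_append_iff.1 hc with ⟨rfl, rfl⟩ | ⟨c, rfl, hc1⟩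
    · have := hb.ht_pos (a := [up, down]) (b := v) rfl (by simp)
      simp at this
    rcases List.cons_eq_append_iff.1 hc1 with ⟨rfl, rfl⟩ | ⟨c, rfl, hc2⟩
    · have := hb.ht_pos (a := [down]) (b := v) rfl (by simp)
      simp at this
    have hcv : v = c ++ b := hc2
    by_cases h0 : c = []
    · subst h0
      have := ha.ht_nonneg (a := u ++ [up]) (b := [down]) (by simp)
      simp at this
    have hpos := hv.ht_pos hcv h0
    simp only [ht_append, ht_cons, up_zero, down_zero] at hR
    refine ⟨by omega, c, b, hcv, fun x y hxy => ⟨fun hx => ?_, ?_⟩, hb, by omega⟩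
    · exact hv.ht_pos (b := y ++ b) (by rw [hcv, hxy, List.append_assoc]) hx
    · exact ha.ht_nonneg (a := u ++ up :: down :: x) (by simp [hxy])
  · left
    have hpos := hb.ht_pos rfl hc
    rw [ht_append] at hL
    refine ⟨by omega, a, c, rfl, ha, fun x y hxy => ⟨fun hx => ?_, ?_⟩, hR⟩
    · exact hb.ht_pos (b := y ++ ([up, down] ++ v)) (by rw [hxy, List.append_assoc]) hx
    · exact hu.ht_nonneg (a := a ++ x) (by rw [hxy, List.append_assoc])

lemma WordBridge.glue_inj {u v u' v' : List (Step d)} (hu : WordBridge u) (hu' : WordBridge u')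
    (hL : ht u = ht u') (h : u ++ ([up, down] ++ v) = u' ++ ([up, down] ++ v')) :
    u = u' ∧ v = v' := by
  rcases List.append_eq_append_iff.1 h with ⟨c, rfl, hc⟩ | ⟨c, rfl, hc⟩
  · rcases List.cons_eq_append_iff.1 hc with ⟨rfl, hc⟩ | ⟨c, rfl, -⟩
    · simpa using hc
    · have := hu'.ht_nonneg (a := u ++ [up]) (b := c) (by simp)
      simp at hL; omega
  · rcases List.cons_eq_append_iff.1 hc with ⟨rfl, hc⟩ | ⟨c, rfl, -⟩
    · simpa using hc.symm
    · have := hu.ht_nonneg (a := u' ++ [up]) (b := c) (by simp)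
      simp at hL; omega

lemma TupleIrreducible.glue [NeZero p] {L L' : ℕ} {u v : Fin p → List (Step d)}
    (hu : TupleIrreducible L u) (hv : TupleIrreducible L' v) :
    TupleIrreducible (L + L') fun j => u j ++ ([up, down] ++ v j) := by
  have h0 := hu.1
  have h0' := hv.1
  refine ⟨by omega, fun j => ⟨(hu.2.1 j).1.glue (hv.2.1 j).1 ?_ ?_, ?_⟩, fun R hR hRL hall => ?_⟩
  · rw [(hu.2.1 j).2]; omega
  · rw [(hv.2.1 j).2]; omega
  · simp [(hu.2.1 j).2, (hv.2.1 j).2]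
  · have key := fun j => (hall j).of_glue (hu.2.1 j).1 (hv.2.1 j).1 (hu.2.1 j).2
    rcases lt_or_ge R L with hlt | hge
    · exact hu.2.2 R hR hlt fun j => ((key j).resolve_right (by omega)).2
    · have hne : R ≠ L := by
        rcases key 0 with h | h <;> omega
      exact hv.2.2 (R - L) (by omega) (by omega) fun j =>
        ((key j).resolve_left (by omega)).2

lemma tupleIrreducible_up : TupleIrreducible 1 fun _ : Fin p => [(up : Step d)] :=
  ⟨one_pos, fun _ => ⟨wordBridge_up, by simp⟩, fun _ h h' => by omega⟩

/-- An irreducible initial piece of a bridge is determined by the bridge. -/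
lemma TupleIrreducible.le_of_append_eq {k k' : ℕ} {u v u' v' : Fin p → List (Step d)}
    (hu : TupleIrreducible k u) (hu' : TupleIrreducible k' u') (hv : ∀ j, WordBridge (v j))
    (h : ∀ j, u j ++ v j = u' j ++ v' j) : k' ≤ k := by
  by_contra! hlt
  refine hu'.2.2 k hu.1 hlt fun j => ?_
  have h1 := (hu.2.1 j).2
  have h2 := (hu'.2.1 j).2
  rcases List.append_eq_append_iff.1 (h j) with ⟨c, hc, hc'⟩ | ⟨c, hc, -⟩
  · refine ⟨u j, c, hc, (hu.2.1 j).1, fun x y hxy => ⟨fun hx => ?_, ?_⟩, h1⟩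
    · exact (hv j).ht_pos (b := y ++ v' j) (by rw [hc', hxy, List.append_assoc]) hx
    · exact (hu'.2.1 j).1.ht_nonneg (a := u j ++ x) (by rw [hc, hxy, List.append_assoc])
  · have := (hu.2.1 j).1.ht_nonneg hc
    rw [hc, ht_append] at h1
    omega

end Gluing

/-! ### Comparing and factoring series in `ℝ≥0∞` -/

section Series

variable {α β : Type*}

lemma tsum_le_tsum_of_injOn {f : α → ℝ≥0∞} {g : β → ℝ≥0∞} (e : α → β)
    (he : Set.InjOn e (Function.support f)) (hfg : ∀ a, f a ≠ 0 → f a ≤ g (e a)) :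
    ∑' a, f a ≤ ∑' b, g b := by
  rw [← tsum_subtype_support f]
  calc ∑' a : Function.support f, f a ≤ ∑' a : Function.support f, g (e a) :=
        ENNReal.tsum_le_tsum fun a => hfg a a.2
    _ ≤ ∑' b, g b := ENNReal.tsum_comp_le_tsum_of_injective
        (f := fun a : Function.support f => e a) he.injective g

lemma tsum_le_tsum_of_exists {f : α → ℝ≥0∞} {g : β → ℝ≥0∞} (c : β → α)
    (h : ∀ a, f a ≠ 0 → ∃ b, c b = a ∧ f a ≤ g b) : ∑' a, f a ≤ ∑' b, g b := by
  classical
  by_cases hβ : Nonempty β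
  · choose! e he hfg using h
    exact tsum_le_tsum_of_injOn e
      (fun a ha a' ha' haa' => by rw [← he a ha, haa', he a' ha']) hfg
  · have : f = 0 := by
      ext a
      by_contra ha
      exact hβ ⟨(h a ha).choose⟩
    simp [this]

lemma tsum_mul_tsum_eq (f : α → ℝ≥0∞) (g : β → ℝ≥0∞) :
    (∑' a, f a) * ∑' b, g b = ∑' x : α × β, f x.1 * g x.2 := by
  rw [ENNReal.tsum_prod', ← ENNReal.tsum_mul_right]
  simp only [ENNReal.tsum_mul_left]

lemma tsum_fin_prod (p : ℕ) (g : α → ℝ≥0∞) :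
    ∑' f : Fin p → α, ∏ j, g (f j) = (∑' a, g a) ^ p := by
  induction p with
  | zero => simp
  | succ p ih =>
    rw [pow_succ', ← ih, tsum_mul_tsum_eq, ← (Fin.consEquiv fun _ : Fin (p + 1) => α).tsum_eq]
    simp [Fin.prod_univ_succ, Fin.consEquiv]

lemma tsum_list_pow_length (α : Type*) [Fintype α] (r : ℝ≥0∞) :
    ∑' w : List α, r ^ w.length = ∑' n : ℕ, (Fintype.card α * r) ^ n := by
  rw [← List.equivSigmaTuple.symm.tsum_eq, ENNReal.tsum_sigma']
  refine tsum_congr fun n => ?_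
  simp [List.equivSigmaTuple, tsum_fintype, mul_pow]

/-- The total weight of tuples of words in `q` letters of weight `r` each is finite if `q * r < 1`. -/
lemma tsum_pow_sum_length_lt_top [Fintype α] {p : ℕ} {r : ℝ≥0∞} (hr : Fintype.card α * r < 1) :
    ∑' m : Fin p → List α, r ^ (∑ j, (m j).length) < ∞ := by
  simp only [← Finset.prod_pow_eq_pow_sum]
  rw [tsum_fin_prod p fun w : List α => r ^ w.length, tsum_list_pow_length,
    ENNReal.tsum_geometric]
  exact ENNReal.pow_lt_top (ENNReal.inv_lt_top.2 (tsub_pos_of_lt hr))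

end Series

/-! ### Weights -/

section Weights

variable {d p : ℕ} [NeZero d] {h β : ℝ} {φ : ℝ → ℝ}

/-- The normalizing constant of one step, `∑_s exp (h * s_1)`. -/
def stepSum (d : ℕ) [NeZero d] (h : ℝ) : ℝ := ∑ s : Step d, Real.exp (h * (s.1 0 : ℝ))

lemma stepSum_pos (d : ℕ) [NeZero d] (h : ℝ) : 0 < stepSum d h :=
  Finset.sum_pos (fun _ _ => Real.exp_pos _) ⟨up, Finset.mem_univ _⟩

/-- The reflection of steps at the origin. -/
def Step.neg : Step d ≃ Step d :=
  (Equiv.neg (Fin d → ℤ)).subtypeEquiv fun v => by simp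

/-- With drift, the normalizing constant exceeds the number of steps, so that paths of length `n`
which return to their starting level have a total weight exponentially small in `n`. The reason
is the symmetry of the steps and `cosh t > 1` for `t ≠ 0`. -/
lemma card_lt_stepSum (hh : 0 < h) : (Fintype.card (Step d) : ℝ) < stepSum d h := by
  have h1 : stepSum d h = ∑ s : Step d, Real.cosh (h * (s.1 0 : ℝ)) := by
    have h2 : stepSum d h = ∑ s : Step d, Real.exp (-(h * (s.1 0 : ℝ))) := by
      unfold stepSum
      rw [← Equiv.sum_comp Step.neg]
      simp [Step.neg]
    simp only [Real.cosh_eq, ← Finset.sum_div, Finset.sum_add_distrib, ← h2]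
    rw [← stepSum]; ring
  rw [h1, Fintype.card_eq_sum_ones, Nat.cast_sum]
  refine Finset.sum_lt_sum (fun s _ => by simp)
    ⟨up, Finset.mem_univ _, ?_⟩
  simpa using hh.ne'

/-- The weight of a single step of a path that returns to its starting level. -/
def stepWeight (d : ℕ) [NeZero d] (h : ℝ) : ℝ≥0∞ := ENNReal.ofReal (1 / stepSum d h)

/-- The probability of the path with steps `w` times `exp (-Φ)`. -/
def wordWeight (h : ℝ) (φ : ℝ → ℝ) (β : ℝ) (w : List (Step d)) : ℝ≥0∞ :=
  ENNReal.ofReal (Real.exp (h * (ht w : ℝ)) * (1 / stepSum d h) ^ w.length *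
    Real.exp (-sitePotential φ β (sites w)))

lemma wordWeight_pos (w : List (Step d)) : 0 < wordWeight h φ β w := by
  have := stepSum_pos d h
  rw [wordWeight, ENNReal.ofReal_pos]
  positivity

lemma wordWeight_ne_top (w : List (Step d)) : wordWeight h φ β w ≠ ∞ := ENNReal.ofReal_ne_top

lemma stepWeight_pow (n : ℕ) :
    stepWeight d h ^ n = ENNReal.ofReal ((1 / stepSum d h) ^ n) :=
  (ENNReal.ofReal_pow (by have := stepSum_pos d h; positivity) n).symm

lemma mul_wordWeight_le (hφ : IsPotentialFunction φ) (hβ : 0 ≤ β) (u v : List (Step d)) :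
    wordWeight h φ β u * wordWeight h φ β v ≤ wordWeight h φ β (u ++ v) := by
  have hZ := stepSum_pos d h
  unfold wordWeight
  rw [← ENNReal.ofReal_mul (by positivity)]
  refine ENNReal.ofReal_le_ofReal ?_
  have h1 := sitePotential_append_le hφ hβ (sites u) ((sites v).map (disp u + ·))
  rw [sitePotential_map_add, ← sites_append] at h1
  calc _ = Real.exp (h * (ht (u ++ v) : ℝ)) * (1 / stepSum d h) ^ (u ++ v).length *
        Real.exp (-(sitePotential φ β (sites u) + sitePotential φ β (sites v))) := by
        simp only [ht_append, List.length_append, Int.cast_add, mul_add, Real.exp_add, pow_add,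
          neg_add]
        ring
    _ ≤ _ := by gcongr

/-- The weights of the two bridges at the ends of a path factor, as the sites visited by these
bridges are distinct; the potential of the middle part is dropped. -/
lemma wordWeight_append_le (hφ : IsPotentialFunction φ) (hβ : 0 ≤ β) {u m v : List (Step d)}
    (hu : WordBridge u) (hm : ht m = 0) (hv : WordBridge v) :
    wordWeight h φ β (u ++ m ++ v) ≤
      wordWeight h φ β u * stepWeight d h ^ m.length * wordWeight h φ β v := by
  have hZ := stepSum_pos d h
  have hdisj : (sites u).Disjoint ((sites v).map (disp (u ++ m) + ·)) := by
    intro x hx hx'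
    obtain ⟨y, hy, rfl⟩ := List.mem_map.1 hx'
    obtain ⟨a, b, hab, -, ha⟩ := exists_of_mem_sites hx
    obtain ⟨a', b', hab', hne, rfl⟩ := exists_of_mem_sites hy
    have h1 := hu.ht_nonneg hab
    have h2 := hv.ht_pos hab' hne
    have h3 : ht a = ht u + ht m + ht a' := by
      simpa [ht] using congrFun ha 0
    rw [hab, ht_append] at h3
    omega
  have h1 := add_le_sitePotential_append hφ hβ (sites u) ((sites m).map (disp u + ·)) _ hdisj
  rw [sitePotential_map_add, ← sites_append, ← sites_append] at h1
  rw [stepWeight_pow]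
  unfold wordWeight
  rw [← ENNReal.ofReal_mul (by positivity), ← ENNReal.ofReal_mul (by positivity)]
  refine ENNReal.ofReal_le_ofReal ?_
  calc _ ≤ Real.exp (h * (ht (u ++ m ++ v) : ℝ)) *
        (1 / stepSum d h) ^ (u ++ m ++ v).length *
        Real.exp (-(sitePotential φ β (sites u) + sitePotential φ β (sites v))) := by gcongr
    _ = _ := by
        simp only [ht_append, hm, add_zero, List.length_append, Int.cast_add, mul_add,
          Real.exp_add, pow_add, neg_add]
        ring

/-- The product of the weights of the words of a tuple. -/
def tupleWeight (h : ℝ) (φ : ℝ → ℝ) (β : ℝ) (w : Fin p → List (Step d)) : ℝ≥0∞ :=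
  ∏ j, wordWeight h φ β (w j)

lemma tupleWeight_pos (w : Fin p → List (Step d)) : 0 < tupleWeight h φ β w :=
  CanonicallyOrderedAdd.prod_pos.2 fun _ _ => wordWeight_pos _

lemma mul_tupleWeight_le (hφ : IsPotentialFunction φ) (hβ : 0 ≤ β)
    (u v : Fin p → List (Step d)) :
    tupleWeight h φ β u * tupleWeight h φ β v ≤ tupleWeight h φ β fun j => u j ++ v j := by
  unfold tupleWeight
  rw [← Finset.prod_mul_distrib]
  exact Finset.prod_le_prod' fun j _ => mul_wordWeight_le hφ hβ _ _

lemma tupleWeight_append_le (hφ : IsPotentialFunction φ) (hβ : 0 ≤ β)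
    {u m v : Fin p → List (Step d)} (hu : ∀ j, WordBridge (u j)) (hm : ∀ j, ht (m j) = 0)
    (hv : ∀ j, WordBridge (v j)) :
    tupleWeight h φ β (fun j => u j ++ m j ++ v j) ≤
      stepWeight d h ^ (∑ j, (m j).length) * (tupleWeight h φ β u * tupleWeight h φ β v) := by
  unfold tupleWeight
  rw [← Finset.prod_pow_eq_pow_sum, ← Finset.prod_mul_distrib, ← Finset.prod_mul_distrib]
  refine Finset.prod_le_prod' fun j _ => ?_
  refine (wordWeight_append_le hφ hβ (hu j) (hm j) (hv j)).trans_eq ?_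
  ring

lemma tupleWeight_append_le_mul (hφ : IsPotentialFunction φ) (hβ : 0 ≤ β)
    {u v : Fin p → List (Step d)} (hu : ∀ j, WordBridge (u j)) (hv : ∀ j, WordBridge (v j)) :
    tupleWeight h φ β (fun j => u j ++ v j) ≤ tupleWeight h φ β u * tupleWeight h φ β v := by
  simpa using tupleWeight_append_le (h := h) (m := fun _ => []) hφ hβ hu (fun _ => rfl) hv

lemma card_mul_stepWeight_lt_one (hh : 0 < h) :
    (Fintype.card (Step d) : ℝ≥0∞) * stepWeight d h < 1 := by
  have hZ := stepSum_pos d h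
  rw [stepWeight, ← ENNReal.ofReal_natCast, ← ENNReal.ofReal_mul (by positivity),
    ENNReal.ofReal_lt_one, mul_one_div, div_lt_one hZ]
  exact card_lt_stepSum hh

/-- The total weight of the pieces between two bridges. -/
def returnSum (d p : ℕ) [NeZero d] (h : ℝ) : ℝ≥0∞ :=
  ∑' m : Fin p → List (Step d), stepWeight d h ^ (∑ j, (m j).length)

lemma returnSum_lt_top (hh : 0 < h) : returnSum d p h < ∞ :=
  tsum_pow_sum_length_lt_top (card_mul_stepWeight_lt_one hh)

lemma one_le_returnSum : 1 ≤ returnSum d p h := by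
  refine le_trans ?_ (ENNReal.le_tsum (fun _ => []))
  simp

end Weights

/-! ### Inequalities between the weights of bridges of different spans -/

section BridgeSums

variable {d p : ℕ} [NeZero d] {h β : ℝ} {φ : ℝ → ℝ}

/-- The total weight of the tuples of words that are bridges of span `L`. -/
def bridgeSum (d p : ℕ) [NeZero d] (h : ℝ) (φ : ℝ → ℝ) (β : ℝ) (L : ℕ) : ℝ≥0∞ :=
  ∑' w : Fin p → List (Step d), {w | TupleBridge L w}.indicator (tupleWeight h φ β) w

/-- The total weight of the tuples of words that are irreducible bridges of span `L`. -/
def irreducibleSum (d p : ℕ) [NeZero d] (h : ℝ) (φ : ℝ → ℝ) (β : ℝ) (L : ℕ) : ℝ≥0∞ :=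
  ∑' w : Fin p → List (Step d), {w | TupleIrreducible L w}.indicator (tupleWeight h φ β) w

lemma irreducibleSum_zero : irreducibleSum d p h φ β 0 = 0 := by
  simp [irreducibleSum, TupleIrreducible]

lemma irreducibleSum_le_bridgeSum (L : ℕ) :
    irreducibleSum d p h φ β L ≤ bridgeSum d p h φ β L :=
  ENNReal.tsum_le_tsum fun _ =>
    Set.indicator_le_indicator_of_subset (fun _ hw => hw.2.1) (fun _ => zero_le) _

lemma bridgeSum_mul_le (hφ : IsPotentialFunction φ) (hβ : 0 ≤ β) (L₁ L₂ : ℕ) :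
    bridgeSum d p h φ β L₁ * bridgeSum d p h φ β L₂ ≤ bridgeSum d p h φ β (L₁ + L₂) := by
  unfold bridgeSum
  rw [tsum_mul_tsum_eq]
  refine tsum_le_tsum_of_injOn (fun x j => x.1 j ++ x.2 j) ?_ ?_
  · rintro ⟨u, v⟩ hx ⟨u', v'⟩ hx' heq
    simp only [Function.mem_support, ne_eq, mul_eq_zero, Set.indicator_apply_eq_zero,
      Set.mem_ofPred_eq, not_or, Classical.not_imp] at hx hx'
    have key := fun j => WordBridge.append_inj
      (((hx.1.1 j).2).trans ((hx'.1.1 j).2).symm) (hx.2.1 j).1 (hx'.2.1 j).1 (congrFun heq j)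
    exact Prod.ext (funext fun j => (key j).1) (funext fun j => (key j).2)
  · rintro ⟨u, v⟩ hx
    simp only [ne_eq, mul_eq_zero, Set.indicator_apply_eq_zero,
      Set.mem_ofPred_eq, not_or, Classical.not_imp] at hx
    have hu : u ∈ {w | TupleBridge L₁ w} := hx.1.1
    have hv : v ∈ {w | TupleBridge L₂ w} := hx.2.1
    have huv : (fun j => u j ++ v j) ∈ {w | TupleBridge (L₁ + L₂) w} := hu.append hv
    simp only [Set.indicator_of_mem hu, Set.indicator_of_mem hv, Set.indicator_of_mem huv]
    exact mul_tupleWeight_le hφ hβ u v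

/-- The total weight of a detour `up, down` for each of the `p` words. -/
def detourWeight (d p : ℕ) [NeZero d] (h : ℝ) (φ : ℝ → ℝ) (β : ℝ) : ℝ≥0∞ :=
  tupleWeight h φ β fun _ : Fin p => [(up : Step d), down]

/-- Inserting the detour `up, down` for each word between two irreducible bridges yields an
irreducible bridge. -/
lemma irreducibleSum_mul_le [NeZero p] (hφ : IsPotentialFunction φ) (hβ : 0 ≤ β) (L₁ L₂ : ℕ) :
    detourWeight d p h φ β * (irreducibleSum d p h φ β L₁ * irreducibleSum d p h φ β L₂) ≤
      irreducibleSum d p h φ β (L₁ + L₂) := by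
  unfold irreducibleSum
  rw [tsum_mul_tsum_eq, ← ENNReal.tsum_mul_left]
  refine tsum_le_tsum_of_injOn (fun x j => x.1 j ++ ([up, down] ++ x.2 j)) ?_ ?_
  · rintro ⟨u, v⟩ hx ⟨u', v'⟩ hx' heq
    simp only [Function.mem_support, ne_eq, mul_eq_zero, Set.indicator_apply_eq_zero,
      Set.mem_ofPred_eq, not_or, Classical.not_imp] at hx hx'
    have key := fun j => WordBridge.glue_inj (hx.2.1.1.2.1 j).1 (hx'.2.1.1.2.1 j).1
      (((hx.2.1.1.2.1 j).2).trans ((hx'.2.1.1.2.1 j).2).symm) (congrFun heq j)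
    exact Prod.ext (funext fun j => (key j).1) (funext fun j => (key j).2)
  · rintro ⟨u, v⟩ hx
    simp only [ne_eq, mul_eq_zero, Set.indicator_apply_eq_zero,
      Set.mem_ofPred_eq, not_or, Classical.not_imp] at hx
    have hu : u ∈ {w | TupleIrreducible L₁ w} := hx.2.1.1
    have hv : v ∈ {w | TupleIrreducible L₂ w} := hx.2.2.1
    have huv : (fun j => u j ++ ([up, down] ++ v j)) ∈ {w | TupleIrreducible (L₁ + L₂) w} :=
      hu.glue hv
    simp only [Set.indicator_of_mem hu, Set.indicator_of_mem hv, Set.indicator_of_mem huv]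
    calc detourWeight d p h φ β * (tupleWeight h φ β u * tupleWeight h φ β v)
        = tupleWeight h φ β u * (detourWeight d p h φ β * tupleWeight h φ β v) := by ring
      _ ≤ tupleWeight h φ β u * tupleWeight h φ β (fun j => [up, down] ++ v j) := by
          gcongr; exact mul_tupleWeight_le hφ hβ _ v
      _ ≤ _ := mul_tupleWeight_le hφ hβ _ _

/-- One direction of the renewal equation: bridges that start with irreducible bridges of
different spans are different. -/
lemma sum_irreducibleSum_mul_le (hφ : IsPotentialFunction φ) (hβ : 0 ≤ β) (L : ℕ) :
    ∑ k ∈ Finset.range (L + 1), irreducibleSum d p h φ β k * bridgeSum d p h φ β (L - k) ≤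
      bridgeSum d p h φ β L := by
  unfold irreducibleSum bridgeSum
  simp only [tsum_mul_tsum_eq]
  rw [← Finset.tsum_subtype, ← ENNReal.tsum_prod (f := fun (k : Finset.range (L + 1))
    (x : (Fin p → List (Step d)) × (Fin p → List (Step d))) =>
    {w | TupleIrreducible k.1 w}.indicator (tupleWeight h φ β) x.1 *
    {w | TupleBridge (L - k.1) w}.indicator (tupleWeight h φ β) x.2)]
  refine tsum_le_tsum_of_injOn (fun x j => x.2.1 j ++ x.2.2 j) ?_ ?_
  · rintro ⟨⟨k, hk⟩, u, v⟩ hx ⟨⟨k', hk'⟩, u', v'⟩ hx' heq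
    simp only [Function.mem_support, ne_eq, mul_eq_zero, Set.indicator_apply_eq_zero,
      Set.mem_ofPred_eq, not_or, Classical.not_imp] at hx hx'
    obtain rfl : k = k' := le_antisymm
      (hx'.1.1.le_of_append_eq hx.1.1 (fun j => (hx'.2.1 j).1) fun j => (congrFun heq j).symm)
      (hx.1.1.le_of_append_eq hx'.1.1 (fun j => (hx.2.1 j).1) fun j => congrFun heq j)
    have key := fun j => WordBridge.append_inj
      (((hx.1.1.2.1 j).2).trans ((hx'.1.1.2.1 j).2).symm) (hx.2.1 j).1 (hx'.2.1 j).1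
      (congrFun heq j)
    rw [funext fun j => (key j).1, funext fun j => (key j).2]
  · rintro ⟨⟨k, hk⟩, u, v⟩ hx
    simp only [ne_eq, mul_eq_zero, Set.indicator_apply_eq_zero,
      Set.mem_ofPred_eq, not_or, Classical.not_imp] at hx
    have hu : u ∈ {w | TupleIrreducible k w} := hx.1.1
    have hv : v ∈ {w | TupleBridge (L - k) w} := hx.2.1
    have huv : (fun j => u j ++ v j) ∈ {w | TupleBridge L w} := by
      have := hu.2.1.append hv
      rwa [Nat.add_sub_cancel' (Finset.mem_range_succ_iff.1 hk)] at this
    simp only [Set.indicator_of_mem hu, Set.indicator_of_mem hv, Set.indicator_of_mem huv]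
    exact mul_tupleWeight_le hφ hβ u v

/-- Cutting bridges at an intermediate level: up to a constant factor, the weight of bridges is
submultiplicative in the span. -/
lemma bridgeSum_add_le (hφ : IsPotentialFunction φ) (hβ : 0 ≤ β) (L₁ L₂ : ℕ) :
    bridgeSum d p h φ β (L₁ + L₂) ≤
      returnSum d p h * (bridgeSum d p h φ β L₁ * bridgeSum d p h φ β L₂) := by
  unfold bridgeSum returnSum
  rw [tsum_mul_tsum_eq, tsum_mul_tsum_eq]
  refine tsum_le_tsum_of_exists (fun x j => x.2.1 j ++ x.1 j ++ x.2.2 j) fun w hw => ?_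
  rw [ne_eq, Set.indicator_apply_eq_zero, Classical.not_imp] at hw
  obtain ⟨u, m, v, hw', hu, hm, hv⟩ := TupleBridge.exists_cut (L₁ := L₁) (L₂ := L₂) hw.1
  have h1 : u ∈ {w | TupleBridge L₁ w} := hu
  have h2 : v ∈ {w | TupleBridge L₂ w} := hv
  refine ⟨⟨m, u, v⟩, (funext hw').symm, ?_⟩
  simp only [Set.indicator_of_mem hw.1, Set.indicator_of_mem h1, Set.indicator_of_mem h2]
  rw [funext hw']
  exact tupleWeight_append_le hφ hβ (fun j => (hu j).1) hm fun j => (hv j).1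

/-- Bridges of span `L` without a breaking level in `(0, r)`, decomposed at their first breaking
level. -/
lemma tsum_bridge_first_break_le (hφ : IsPotentialFunction φ) (hβ : 0 ≤ β) {L : ℕ} (hL : 0 < L)
    (r : ℕ) :
    ∑' w : Fin p → List (Step d),
      {w | TupleBridge L w ∧ ∀ R, 0 < R → R < r → ¬ ∀ j, BreaksAt (w j) R}.indicator
        (tupleWeight h φ β) w ≤
    ∑ i ∈ Finset.Icc r L, irreducibleSum d p h φ β i * bridgeSum d p h φ β (L - i) := by
  unfold irreducibleSum bridgeSum
  simp only [tsum_mul_tsum_eq]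
  rw [← Finset.tsum_subtype, ← ENNReal.tsum_prod (f := fun (k : Finset.Icc r L)
    (x : (Fin p → List (Step d)) × (Fin p → List (Step d))) =>
    {w | TupleIrreducible k.1 w}.indicator (tupleWeight h φ β) x.1 *
    {w | TupleBridge (L - k.1) w}.indicator (tupleWeight h φ β) x.2)]
  refine tsum_le_tsum_of_exists (fun x j => x.2.1 j ++ x.2.2 j) fun w hw => ?_
  rw [ne_eq, Set.indicator_apply_eq_zero, Classical.not_imp] at hw
  obtain ⟨i, hri, hiL, a, b, hab, ha, hb⟩ := hw.1.1.exists_first_break hL hw.1.2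
  have h1 : a ∈ {w | TupleIrreducible i w} := ha
  have h2 : b ∈ {w | TupleBridge (L - i) w} := hb
  refine ⟨⟨⟨i, Finset.mem_Icc.2 ⟨hri, hiL⟩⟩, a, b⟩, (funext hab).symm, ?_⟩
  simp only [Set.indicator_of_mem hw.1, Set.indicator_of_mem h1, Set.indicator_of_mem h2]
  rw [funext hab]
  exact tupleWeight_append_le_mul hφ hβ (fun j => (ha.2.1 j).1) fun j => (hb j).1

/-- Bridges of span `L` without a breaking level in `(r, L)`, decomposed at their last breaking
level below `L`. -/
lemma tsum_bridge_last_break_le (hφ : IsPotentialFunction φ) (hβ : 0 ≤ β) {L : ℕ} (hL : 0 < L)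
    (r : ℕ) :
    ∑' w : Fin p → List (Step d),
      {w | TupleBridge L w ∧ ∀ R, r < R → R < L → ¬ ∀ j, BreaksAt (w j) R}.indicator
        (tupleWeight h φ β) w ≤
    ∑ i ∈ Finset.range (r + 1), bridgeSum d p h φ β i * irreducibleSum d p h φ β (L - i) := by
  unfold irreducibleSum bridgeSum
  simp only [tsum_mul_tsum_eq]
  rw [← Finset.tsum_subtype, ← ENNReal.tsum_prod (f := fun (k : Finset.range (r + 1))
    (x : (Fin p → List (Step d)) × (Fin p → List (Step d))) =>
    {w | TupleBridge k.1 w}.indicator (tupleWeight h φ β) x.1 *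
    {w | TupleIrreducible (L - k.1) w}.indicator (tupleWeight h φ β) x.2)]
  refine tsum_le_tsum_of_exists (fun x j => x.2.1 j ++ x.2.2 j) fun w hw => ?_
  rw [ne_eq, Set.indicator_apply_eq_zero, Classical.not_imp] at hw
  obtain ⟨i, hri, hiL, a, b, hab, ha, hb⟩ := hw.1.1.exists_last_break hL hw.1.2
  have h1 : a ∈ {w | TupleBridge i w} := ha
  have h2 : b ∈ {w | TupleIrreducible (L - i) w} := hb
  refine ⟨⟨⟨i, Finset.mem_range_succ_iff.2 hri⟩, a, b⟩, (funext hab).symm, ?_⟩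
  simp only [Set.indicator_of_mem hw.1, Set.indicator_of_mem h1, Set.indicator_of_mem h2]
  rw [funext hab]
  exact tupleWeight_append_le_mul hφ hβ (fun j => (ha j).1) fun j => (hb.2.1 j).1

/-- Cutting irreducible bridges at the level `L₁`. The sum is over the pieces `m` between the first
and the last visits to this level; the parts before and after have no breaking levels except at
distance at most the total length of `m` from the cut. -/
lemma irreducibleSum_add_le (hφ : IsPotentialFunction φ) (hβ : 0 ≤ β) {L₁ L₂ : ℕ}
    (h₁ : 0 < L₁) (h₂ : 0 < L₂) :
    irreducibleSum d p h φ β (L₁ + L₂) ≤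
      ∑' m : Fin p → List (Step d), stepWeight d h ^ (∑ j, (m j).length) *
        ((∑ i ∈ Finset.Icc (L₁ - ∑ j, (m j).length) L₁,
            irreducibleSum d p h φ β i * bridgeSum d p h φ β (L₁ - i)) *
          ∑ i ∈ Finset.range (∑ j, (m j).length + 1),
            bridgeSum d p h φ β i * irreducibleSum d p h φ β (L₂ - i)) := by
  calc irreducibleSum d p h φ β (L₁ + L₂)
      ≤ ∑' m : Fin p → List (Step d), stepWeight d h ^ (∑ j, (m j).length) *
        ((∑' w : Fin p → List (Step d),
          {w | TupleBridge L₁ w ∧ ∀ R, 0 < R → R < L₁ - ∑ j, (m j).length →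
            ¬ ∀ j, BreaksAt (w j) R}.indicator (tupleWeight h φ β) w) *
        ∑' w : Fin p → List (Step d),
          {w | TupleBridge L₂ w ∧ ∀ R, ∑ j, (m j).length < R → R < L₂ →
            ¬ ∀ j, BreaksAt (w j) R}.indicator (tupleWeight h φ β) w) := by
        unfold irreducibleSum
        simp only [tsum_mul_tsum_eq]
        simp only [← ENNReal.tsum_mul_left]
        rw [← ENNReal.tsum_prod (f := fun (m : Fin p → List (Step d))
          (x : (Fin p → List (Step d)) × (Fin p → List (Step d))) =>
          stepWeight d h ^ (∑ j, (m j).length) *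
          ({w | TupleBridge L₁ w ∧ ∀ R, 0 < R → R < L₁ - ∑ j, (m j).length →
            ¬ ∀ j, BreaksAt (w j) R}.indicator (tupleWeight h φ β) x.1 *
          {w | TupleBridge L₂ w ∧ ∀ R, ∑ j, (m j).length < R → R < L₂ →
            ¬ ∀ j, BreaksAt (w j) R}.indicator (tupleWeight h φ β) x.2))]
        refine tsum_le_tsum_of_exists (fun x j => x.2.1 j ++ x.1 j ++ x.2.2 j) fun w hw => ?_
        rw [ne_eq, Set.indicator_apply_eq_zero, Classical.not_imp] at hw
        obtain ⟨u, m, v, hw', hu, hm, hv, hbu, hbv⟩ :=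
          TupleIrreducible.exists_cut (L₁ := L₁) (L₂ := L₂) hw.1
        refine ⟨⟨m, u, v⟩, (funext hw').symm, ?_⟩
        have h1 : u ∈ {w | TupleBridge L₁ w ∧ ∀ R, 0 < R → R < L₁ - ∑ j, (m j).length →
            ¬ ∀ j, BreaksAt (w j) R} := ⟨hu, hbu⟩
        have h2 : v ∈ {w | TupleBridge L₂ w ∧ ∀ R, ∑ j, (m j).length < R → R < L₂ →
            ¬ ∀ j, BreaksAt (w j) R} := ⟨hv, hbv⟩
        simp only [Set.indicator_of_mem hw.1, Set.indicator_of_mem h1, Set.indicator_of_mem h2]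
        rw [funext hw']
        exact tupleWeight_append_le hφ hβ (fun j => (hu j).1) hm fun j => (hv j).1
    _ ≤ _ := by
        gcongr with m
        · exact tsum_bridge_first_break_le hφ hβ h₁ _
        · exact tsum_bridge_last_break_le hφ hβ h₂ _

/-! ### Positivity and finiteness -/

lemma irreducibleSum_one_pos : 0 < irreducibleSum d p h φ β 1 := by
  refine lt_of_lt_of_le ?_ (ENNReal.le_tsum fun _ => [up])
  rw [Set.indicator_of_mem (s := {w | TupleIrreducible 1 w}) tupleIrreducible_up]
  exact tupleWeight_pos _

lemma irreducibleSum_pos [NeZero p] (hφ : IsPotentialFunction φ) (hβ : 0 ≤ β) {L : ℕ}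
    (hL : 0 < L) : 0 < irreducibleSum d p h φ β L := by
  induction L, hL using Nat.le_induction with
  | base => exact irreducibleSum_one_pos
  | succ L _ ih =>
    refine lt_of_lt_of_le ?_ (irreducibleSum_mul_le hφ hβ L 1)
    exact ENNReal.mul_pos (tupleWeight_pos _).ne'
      (ENNReal.mul_pos ih.ne' irreducibleSum_one_pos.ne').ne'

lemma one_le_bridgeSum_zero (hφ : IsPotentialFunction φ) : 1 ≤ bridgeSum d p h φ β 0 := by
  refine le_trans ?_ (ENNReal.le_tsum fun _ => [])
  rw [Set.indicator_of_mem (s := {w | TupleBridge 0 w}) (fun _ => ⟨wordBridge_nil, rfl⟩)]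
  simp [tupleWeight, wordWeight, sites, sitePotential, hφ.zero]

lemma bridgeSum_pos [NeZero p] (hφ : IsPotentialFunction φ) (hβ : 0 ≤ β) (L : ℕ) :
    0 < bridgeSum d p h φ β L := by
  rcases Nat.eq_zero_or_pos L with rfl | hL
  · exact one_pos.trans_le (one_le_bridgeSum_zero hφ)
  · exact (irreducibleSum_pos hφ hβ hL).trans_le (irreducibleSum_le_bridgeSum L)

/-- The weights of bridges grow at most exponentially in the span. -/
lemma bridgeSum_le (hφ : IsPotentialFunction φ) (hβ : 0 ≤ β) (L : ℕ) :
    bridgeSum d p h φ β L ≤ ENNReal.ofReal (Real.exp (h * L)) ^ p * returnSum d p h := by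
  unfold bridgeSum returnSum
  rw [← ENNReal.tsum_mul_left]
  refine ENNReal.tsum_le_tsum fun w => Set.indicator_apply_le'
    (fun hw : TupleBridge L w => ?_) fun _ => zero_le
  have hZ := stepSum_pos d h
  rw [tupleWeight, ← Finset.prod_pow_eq_pow_sum, ← Fin.prod_const, ← Finset.prod_mul_distrib]
  refine Finset.prod_le_prod' fun j _ => ?_
  rw [wordWeight, (hw j).2, stepWeight_pow, ← ENNReal.ofReal_mul (by positivity)]
  refine ENNReal.ofReal_le_ofReal (mul_le_of_le_one_right (by positivity) ?_)
  exact Real.exp_le_one_iff.2 (neg_nonpos.2 (sitePotential_nonneg hφ hβ _))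

lemma bridgeSum_lt_top (hh : 0 < h) (hφ : IsPotentialFunction φ) (hβ : 0 ≤ β) (L : ℕ) :
    bridgeSum d p h φ β L < ∞ :=
  (bridgeSum_le hφ hβ L).trans_lt
    (ENNReal.mul_lt_top (ENNReal.pow_lt_top ENNReal.ofReal_lt_top) (returnSum_lt_top hh))

end BridgeSums

/-! ### Decay rates of almost supermultiplicative sequences -/

section Rates

/-- Fekete's lemma: the decay rate of an almost supermultiplicative sequence of at most exponential
growth exists, and bounds the sequence. -/
lemma exists_tendsto_rate {a : ℕ → ℝ≥0∞} {c C K : ℝ} (hc : 0 < c) (hC : 0 < C) (hK : 0 < K)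
    (hpos : ∀ n, 0 < n → 0 < (a n).toReal)
    (hmul : ∀ m n, 0 < m → 0 < n →
      c * ((a m).toReal * (a n).toReal) ≤ (a (m + n)).toReal)
    (hgrow : ∀ n, 0 < n → (a n).toReal ≤ C * K ^ n) :
    ∃ μ : ℝ, Tendsto (rate a) atTop (𝓝 μ) ∧
      ∀ n, 0 < n → c * (a n).toReal ≤ Real.exp (-μ * n) := by
  set u : ℕ → ℝ := fun n => if n = 0 then 0 else -Real.log (c * (a n).toReal) with hu
  have hu' : ∀ n, 0 < n → u n = -Real.log (c * (a n).toReal) := fun n hn => if_neg hn.ne'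
  have hsub : Subadditive u := by
    intro m n
    rcases Nat.eq_zero_or_pos m with rfl | hm
    · simp [hu]
    rcases Nat.eq_zero_or_pos n with rfl | hn
    · simp [hu]
    have h1 := hpos m hm
    have h2 := hpos n hn
    rw [hu' _ (by omega), hu' m hm, hu' n hn, ← neg_add, ← Real.log_mul (by positivity)
      (by positivity), neg_le_neg_iff]
    refine Real.log_le_log (by positivity) ?_
    nlinarith [mul_le_mul_of_nonneg_left (hmul m n hm hn) hc.le]
  have hbdd : BddBelow (Set.range fun n : ℕ => u n / n) := by
    refine ⟨-|Real.log (c * C)| - |Real.log K|, ?_⟩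
    rintro _ ⟨n, rfl⟩
    dsimp only
    rcases Nat.eq_zero_or_pos n with rfl | hn
    · simp only [Nat.cast_zero, div_zero]
      linarith [abs_nonneg (Real.log (c * C)), abs_nonneg (Real.log K)]
    have hn' : (1 : ℝ) ≤ n := by exact_mod_cast hn
    have h1 := hpos n hn
    rw [hu' n hn, le_div_iff₀ (by positivity)]
    have h2 : Real.log (c * (a n).toReal) ≤ Real.log (c * C) + n * Real.log K := by
      rw [← Real.log_pow, ← Real.log_mul (by positivity) (by positivity)]
      refine Real.log_le_log (by positivity) ?_
      nlinarith [mul_le_mul_of_nonneg_left (hgrow n hn) hc.le]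
    nlinarith [le_abs_self (Real.log (c * C)), le_abs_self (Real.log K),
      abs_nonneg (Real.log (c * C)), abs_nonneg (Real.log K)]
  refine ⟨hsub.lim, ?_, fun n hn => ?_⟩
  · have h1 := hsub.tendsto_lim hbdd
    have h2 : Tendsto (fun n : ℕ => Real.log c / (n : ℝ)) atTop (𝓝 0) :=
      tendsto_const_div_atTop_nhds_zero_nat _
    have h3 := h1.add h2
    rw [add_zero] at h3
    refine h3.congr' ?_
    filter_upwards [eventually_gt_atTop 0] with n hn
    rw [hu' n hn, Real.log_mul hc.ne' (hpos n hn).ne', rate]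
    ring
  · have h1 := hsub.lim_le_div hbdd hn.ne'
    have h2 := hpos n hn
    have h3 : (0 : ℝ) < n := by exact_mod_cast hn
    rw [hu' n hn, le_div_iff₀ h3] at h1
    rw [← Real.log_le_iff_le_exp (by positivity)]
    linarith

/-- The decay rate of an almost submultiplicative sequence bounds it from below. -/
lemma exp_le_of_tendsto_rate {a : ℕ → ℝ≥0∞} {μ G : ℝ} (hG : 0 < G)
    (hpos : ∀ n, 0 < (a n).toReal)
    (hmul : ∀ m n, (a (m + n)).toReal ≤ G * ((a m).toReal * (a n).toReal))
    (hrate : Tendsto (rate a) atTop (𝓝 μ)) {n : ℕ} (hn : 0 < n) :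
    Real.exp (-μ * n) ≤ G * (a n).toReal := by
  have hsub : Subadditive fun n => Real.log (G * (a n).toReal) := by
    intro m n
    have h1 := hpos m
    have h2 := hpos n
    have h3 := hpos (m + n)
    dsimp only
    rw [← Real.log_mul (by positivity) (by positivity)]
    refine Real.log_le_log (by positivity) ?_
    nlinarith [mul_le_mul_of_nonneg_left (hmul m n) hG.le]
  have hlim : Tendsto (fun n : ℕ => Real.log (G * (a n).toReal) / n) atTop (𝓝 (-μ)) := by
    have h2 : Tendsto (fun n : ℕ => Real.log G / (n : ℝ)) atTop (𝓝 0) :=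
      tendsto_const_div_atTop_nhds_zero_nat _
    have h3 := h2.sub hrate
    rw [zero_sub] at h3
    refine h3.congr fun n => ?_
    rw [Real.log_mul hG.ne' (hpos n).ne', rate]
    ring
  have h1 := hpos n
  have h3 : (0 : ℝ) < n := by exact_mod_cast hn
  rw [← Real.le_log_iff_exp_le (by positivity), ← le_div_iff₀ h3]
  by_contra! hlt
  obtain ⟨r, hr, hr'⟩ := exists_between hlt
  have hev := hsub.eventually_div_lt_of_div_lt hn.ne' hr
  exact absurd (le_of_tendsto hlim (hev.mono fun _ h => h.le)) (not_le.2 hr')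

/-- A sequence that decays faster than `exp (-μ n)` by a factor `w ^ n` has decay rate at least
`μ + log w`. -/
lemma le_of_tendsto_rate {a : ℕ → ℝ≥0∞} {μ ν w A : ℝ} (hw : 0 < w)
    (hpos : ∀ n, 0 < n → 0 < (a n).toReal)
    (hle : ∀ n, 0 < n → (a n).toReal * Real.exp (μ * n) * w ^ n ≤ A)
    (hrate : Tendsto (rate a) atTop (𝓝 ν)) : μ + Real.log w ≤ ν := by
  have h1 : Tendsto (fun n : ℕ => μ + Real.log w - Real.log A / (n : ℝ)) atTop
      (𝓝 (μ + Real.log w - 0)) :=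
    tendsto_const_nhds.sub (tendsto_const_div_atTop_nhds_zero_nat _)
  rw [sub_zero] at h1
  refine le_of_tendsto_of_tendsto h1 hrate ?_
  filter_upwards [eventually_gt_atTop 0] with n hn
  have h2 := hpos n hn
  have h3 : (0 : ℝ) < n := by exact_mod_cast hn
  have h4 := Real.log_le_log (by positivity) (hle n hn)
  rw [Real.log_mul (by positivity) (by positivity), Real.log_mul (by positivity) (by positivity),
    Real.log_exp, Real.log_pow] at h4
  rw [rate, le_div_iff₀ h3, sub_mul, div_mul_cancel₀ _ h3.ne']
  linarith

end Rates

/-! ### Exponential decay from a recursive inequality -/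

section Decay

/-- A null sequence `T` is exponentially decaying if, up to errors `s i` with exponential moments,
`T (m + n) ≤ ∑ i, q i * T m * T n`. -/
lemma exists_exponential_decay {ι : Type*} {T : ℕ → ℝ≥0∞} {s : ι → ℕ} {q : ι → ℝ≥0∞} {z : ℝ≥0}
    (hz : 1 < z) (hq : ∑' i, q i * (z : ℝ≥0∞) ^ s i ≠ ∞) (hT0 : ∀ n, T n ≤ T 0)
    (hT0' : T 0 ≠ ∞) (hT : Tendsto T atTop (𝓝 0))
    (hrec : ∀ m n, 0 < m → 0 < n → T (m + n) ≤ ∑' i, q i * (T (m - s i) * T (n - s i))) :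
    ∃ w : ℝ≥0, 1 < w ∧ ∃ A : ℝ≥0∞, A ≠ ∞ ∧ ∀ n, T n * (w : ℝ≥0∞) ^ n ≤ A := by
  -- for a large block length `M`, one block contributes a factor at most `1 / 2`
  have hlim : Tendsto (fun M => ∑' i, q i * (z : ℝ≥0∞) ^ s i * T (M - s i)) atTop (𝓝 0) := by
    let _ : MeasurableSpace ι := ⊤
    have h1 := tendsto_lintegral_of_dominated_convergence (μ := Measure.count)
      (F := fun M i => q i * (z : ℝ≥0∞) ^ s i * T (M - s i)) (f := fun _ => 0)
      (fun i => q i * (z : ℝ≥0∞) ^ s i * T 0) (fun _ => measurable_from_top)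
      (fun M => Eventually.of_forall fun i => by dsimp only; gcongr; exact hT0 _)
      (by
        rw [lintegral_count, ENNReal.tsum_mul_right]
        exact ENNReal.mul_ne_top hq hT0')
      (Eventually.of_forall fun i => by
        have hi : q i * (z : ℝ≥0∞) ^ s i ≠ ∞ := ENNReal.ne_top_of_tsum_ne_top hq i
        have h2 : Tendsto (fun M => T (M - s i)) atTop (𝓝 0) :=
          hT.comp (tendsto_sub_atTop_nat _)
        simpa using ENNReal.Tendsto.const_mul h2 (Or.inr hi))
    simpa [lintegral_count] using h1
  obtain ⟨M, hM, hMpos⟩ := ((hlim.eventually_le_const (u := 2⁻¹) (by simp)).and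
    (eventually_gt_atTop 0)).exists
  obtain ⟨w, ⟨hwM, hwz⟩, hw⟩ : ∃ w : ℝ≥0, (w ^ M < 2 ∧ w < z) ∧ 1 < w := by
    have h1 : ∀ᶠ w : ℝ≥0 in 𝓝 1, w ^ M < 2 ∧ w < z :=
      (((continuous_pow M).tendsto' (1 : ℝ≥0) 1 (one_pow M)).eventually_lt_const
        one_lt_two).and (eventually_lt_nhds hz)
    exact ((h1.filter_mono nhdsWithin_le_nhds).and
      (self_mem_nhdsWithin (s := Set.Ioi (1 : ℝ≥0)))).exists
  have hw1 : (1 : ℝ≥0∞) ≤ w := by exact_mod_cast hw.le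
  have hwz' : (w : ℝ≥0∞) ≤ z := by exact_mod_cast hwz.le
  refine ⟨w, hw, T 0 * (w : ℝ≥0∞) ^ M, ENNReal.mul_ne_top hT0' (by finiteness), fun n => ?_⟩
  induction n using Nat.strong_induction_on with
  | _ n ih =>
  rcases le_or_gt n M with hn | hn
  · exact mul_le_mul' (hT0 n) (pow_le_pow_right₀ hw1 hn)
  obtain ⟨L, rfl⟩ := Nat.exists_eq_add_of_lt hn
  set N := L + 1 with hN
  rw [show M + L + 1 = M + N by omega] at ih ⊢
  set A := T 0 * (w : ℝ≥0∞) ^ M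
  calc T (M + N) * (w : ℝ≥0∞) ^ (M + N)
      ≤ (∑' i, q i * (T (M - s i) * T (N - s i))) * (w : ℝ≥0∞) ^ (M + N) := by
        gcongr; exact hrec M N hMpos (by omega)
    _ = ∑' i, (w : ℝ≥0∞) ^ M * (q i * T (M - s i) * (T (N - s i) * (w : ℝ≥0∞) ^ N)) := by
        rw [← ENNReal.tsum_mul_right]
        exact tsum_congr fun i => by ring
    _ ≤ ∑' i, (w : ℝ≥0∞) ^ M * (q i * T (M - s i) * (A * (z : ℝ≥0∞) ^ s i)) := by
        refine ENNReal.tsum_le_tsum fun i => ?_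
        gcongr _ * (_ * ?_)
        calc T (N - s i) * (w : ℝ≥0∞) ^ N
            ≤ T (N - s i) * ((w : ℝ≥0∞) ^ (N - s i) * (w : ℝ≥0∞) ^ s i) := by
              rw [← pow_add]
              gcongr
              omega
          _ = T (N - s i) * (w : ℝ≥0∞) ^ (N - s i) * (w : ℝ≥0∞) ^ s i := by ring
          _ ≤ A * (z : ℝ≥0∞) ^ s i := by
              gcongr
              exact ih _ (by omega)
    _ = (w : ℝ≥0∞) ^ M * A * ∑' i, q i * (z : ℝ≥0∞) ^ s i * T (M - s i) := by
        rw [← ENNReal.tsum_mul_left]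
        exact tsum_congr fun i => by ring
    _ ≤ 2 * A * 2⁻¹ := by
        gcongr
        exact_mod_cast hwM.le
    _ = A := by
        rw [mul_comm 2 A, mul_assoc, ENNReal.mul_inv_cancel (by simp) (by simp), mul_one]

end Decay

/-! ### The gap between the decay rates -/

section Gap

variable {d p : ℕ} [NeZero d] {h β : ℝ} {φ : ℝ → ℝ}

/-- As `f 0 = 0`, the truncated subtraction only adds vanishing terms to a tail of the series. -/
lemma tsum_comp_sub_le {f : ℕ → ℝ≥0∞} (hf : f 0 = 0) {L s i : ℕ} (hi : i ≤ s) :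
    ∑' k, f (k + L - i) ≤ ∑' k, f (k + (L - s)) := by
  refine tsum_le_tsum_of_injOn (fun k => k + L - i - (L - s)) ?_ fun k _ => ?_
  · intro k hk k' hk' heq
    have h1 : k + L - i ≠ 0 := fun h0 => hk (by simp only [h0, hf])
    have h2 : k' + L - i ≠ 0 := fun h0 => hk' (by simp only [h0, hf])
    dsimp only at heq
    omega
  · rw [Nat.sub_add_cancel (by omega)]

lemma sum_Icc_le_tsum (f : ℕ → ℝ≥0∞) (r L : ℕ) :
    ∑ i ∈ Finset.Icc r L, f i ≤ ∑' k, f (k + r) := by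
  rw [← Finset.tsum_subtype]
  refine tsum_le_tsum_of_injOn (fun i : Finset.Icc r L => i.1 - r) ?_ ?_
  · rintro ⟨i, hi⟩ - ⟨i', hi'⟩ - heq
    rw [Finset.mem_Icc] at hi hi'
    simp only [Subtype.mk.injEq] at heq ⊢
    omega
  · rintro ⟨i, hi⟩ -
    rw [Nat.sub_add_cancel (Finset.mem_Icc.1 hi).1]

/-- The tails `T` of the weights of irreducible bridges, normalized by the decay rate of bridges,
satisfy an approximate submultiplicativity. Here `x` is the exponential of that decay rate. -/
lemma tail_add_le (hφ : IsPotentialFunction φ) (hβ : 0 ≤ β) {x : ℝ≥0∞}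
    (hx : ∀ n, bridgeSum d p h φ β n * x ^ n ≤ 1) {L₁ L₂ : ℕ} (h₁ : 0 < L₁) (h₂ : 0 < L₂) :
    ∑' k, irreducibleSum d p h φ β (k + (L₁ + L₂)) * x ^ (k + (L₁ + L₂)) ≤
      ∑' m : Fin p → List (Step d),
        stepWeight d h ^ (∑ j, (m j).length) * (∑ j, (m j).length + 1 : ℕ) *
          ((∑' k, irreducibleSum d p h φ β (k + (L₁ - ∑ j, (m j).length)) *
              x ^ (k + (L₁ - ∑ j, (m j).length))) *
            ∑' k, irreducibleSum d p h φ β (k + (L₂ - ∑ j, (m j).length)) *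
              x ^ (k + (L₂ - ∑ j, (m j).length))) := by
  set B := bridgeSum d p h φ β
  set Λ := irreducibleSum d p h φ β with hΛ
  set f : ℕ → ℝ≥0∞ := fun k => Λ k * x ^ k with hf
  have hf0 : f 0 = 0 := by simp [hf, hΛ, irreducibleSum_zero]
  set len : (Fin p → List (Step d)) → ℕ := fun m => ∑ j, (m j).length with hlen
  have key : ∀ k, f (k + (L₁ + L₂)) ≤ ∑' m : Fin p → List (Step d),
      stepWeight d h ^ len m * ((∑' k, f (k + (L₁ - len m))) *
        ∑ i ∈ Finset.range (len m + 1), f (k + L₂ - i)) := by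
    intro k
    calc f (k + (L₁ + L₂)) = Λ (L₁ + (k + L₂)) * (x ^ L₁ * x ^ (k + L₂)) := by
          rw [← pow_add, hf, show k + (L₁ + L₂) = L₁ + (k + L₂) by omega]
      _ ≤ _ := mul_le_mul_left (irreducibleSum_add_le hφ hβ h₁ (by omega)) _
      _ = ∑' m : Fin p → List (Step d), stepWeight d h ^ len m *
          ((∑ i ∈ Finset.Icc (L₁ - len m) L₁, Λ i * B (L₁ - i) * x ^ L₁) *
          ∑ i ∈ Finset.range (len m + 1), B i * Λ (k + L₂ - i) * x ^ (k + L₂)) := by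
          rw [← ENNReal.tsum_mul_right]
          refine tsum_congr fun m => ?_
          rw [← Finset.sum_mul, ← Finset.sum_mul]
          ring
      _ ≤ _ := by
          gcongr with m i hi
          · refine le_trans (Finset.sum_le_sum fun i hi => ?_) (sum_Icc_le_tsum f _ L₁)
            calc Λ i * B (L₁ - i) * x ^ L₁ = Λ i * x ^ i * (B (L₁ - i) * x ^ (L₁ - i)) := by
                  rw [← pow_mul_pow_sub x (Finset.mem_Icc.1 hi).2]; ring
              _ ≤ Λ i * x ^ i * 1 := by gcongr; exact hx _
              _ = f i := mul_one _
          · rcases le_or_gt i (k + L₂) with hle | hgt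
            · calc B i * Λ (k + L₂ - i) * x ^ (k + L₂)
                  = (B i * x ^ i) * (Λ (k + L₂ - i) * x ^ (k + L₂ - i)) := by
                    rw [← pow_mul_pow_sub x hle]; ring
                _ ≤ 1 * (Λ (k + L₂ - i) * x ^ (k + L₂ - i)) := by gcongr; exact hx _
                _ = f (k + L₂ - i) := one_mul _
            · rw [Nat.sub_eq_zero_of_le hgt.le, hΛ, irreducibleSum_zero]
              simp
  calc ∑' k, f (k + (L₁ + L₂)) ≤ _ := ENNReal.tsum_le_tsum key
    _ = ∑' m : Fin p → List (Step d), stepWeight d h ^ len m *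
          ((∑' k, f (k + (L₁ - len m))) *
            ∑ i ∈ Finset.range (len m + 1), ∑' k, f (k + L₂ - i)) := by
        rw [ENNReal.tsum_comm]
        refine tsum_congr fun m => ?_
        rw [ENNReal.tsum_mul_left, ENNReal.tsum_mul_left,
          Summable.tsum_finsetSum fun _ _ => ENNReal.summable]
    _ ≤ ∑' m : Fin p → List (Step d), stepWeight d h ^ len m *
          ((∑' k, f (k + (L₁ - len m))) *
            ∑ i ∈ Finset.range (len m + 1), ∑' k, f (k + (L₂ - len m))) := by
        gcongr ∑' m, _ * (_ * ?_) with m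
        exact Finset.sum_le_sum fun i hi =>
          tsum_comp_sub_le hf0 (Finset.mem_range_succ_iff.1 hi)
    _ = _ := by
        refine tsum_congr fun m => ?_
        rw [Finset.sum_const, Finset.card_range, nsmul_eq_mul]
        ring

/-- The pieces between the first and the last visit to a level have exponential moments. -/
lemma exists_exponential_moment (hh : 0 < h) :
    ∃ z : ℝ≥0, 1 < z ∧ ∑' m : Fin p → List (Step d),
      stepWeight d h ^ (∑ j, (m j).length) * (∑ j, (m j).length + 1 : ℕ) *
        (z : ℝ≥0∞) ^ (∑ j, (m j).length) ≠ ∞ := by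
  -- the factor `n + 1` is absorbed by a second exponential factor
  obtain ⟨z, hz, hz1⟩ : ∃ z : ℝ≥0,
      Fintype.card (Step d) * (stepWeight d h * ((z * z : ℝ≥0) : ℝ≥0∞)) < 1 ∧ 1 < z := by
    have h1 : Tendsto (fun z : ℝ≥0 => (Fintype.card (Step d) : ℝ≥0∞) *
        (stepWeight d h * ((z * z : ℝ≥0) : ℝ≥0∞))) (𝓝 1)
        (𝓝 (Fintype.card (Step d) * (stepWeight d h * 1))) := by
      refine ENNReal.Tendsto.const_mul (ENNReal.Tendsto.const_mul ?_ (Or.inr ?_)) (Or.inr ?_)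
      · refine ENNReal.tendsto_coe.2 ?_
        exact ((continuous_id.mul continuous_id).tendsto' (1 : ℝ≥0) 1 (by simp))
      · exact ENNReal.ofReal_ne_top
      · exact ENNReal.natCast_ne_top _
    rw [mul_one] at h1
    exact (((h1.eventually_lt_const (card_mul_stepWeight_lt_one hh)).filter_mono
      nhdsWithin_le_nhds).and (self_mem_nhdsWithin (s := Set.Ioi (1 : ℝ≥0)))).exists
  obtain ⟨C, hC⟩ : ∃ C : ℝ≥0, ∀ n : ℕ, ((n + 1 : ℕ) : ℝ≥0) ≤ C * z ^ n := by
    obtain ⟨ε, rfl⟩ : ∃ ε, z = 1 + ε := ⟨z - 1, (add_tsub_cancel_of_le hz1.le).symm⟩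
    have hε : 0 < ε := by simpa using hz1
    refine ⟨1 + ε⁻¹, fun n => ?_⟩
    have h1 : 1 + (n : ℝ≥0) * ε ≤ (1 + ε) ^ n := one_add_mul_le_pow_of_sq_nonneg zero_le zero_le zero_le n
    calc ((n + 1 : ℕ) : ℝ≥0) ≤ (1 + ε⁻¹) * (1 + n * ε) := by
          have : (1 + ε⁻¹) * (1 + n * ε) = (n + 1 : ℕ) + (ε⁻¹ + n * ε) := by
            push_cast; field_simp; ring
          rw [this]; exact le_self_add
      _ ≤ _ := by gcongr
  refine ⟨z, hz1, ne_top_of_le_ne_top (b := C * ∑' m : Fin p → List (Step d),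
    (stepWeight d h * ((z * z : ℝ≥0) : ℝ≥0∞)) ^ (∑ j, (m j).length)) ?_ ?_⟩
  · exact ENNReal.mul_ne_top ENNReal.coe_ne_top (tsum_pow_sum_length_lt_top hz).ne
  · rw [← ENNReal.tsum_mul_left]
    refine ENNReal.tsum_le_tsum fun m => ?_
    generalize ∑ j, (m j).length = n
    have h1 : ((n + 1 : ℕ) : ℝ≥0∞) ≤ C * (z : ℝ≥0∞) ^ n := by exact_mod_cast hC n
    calc stepWeight d h ^ n * ((n + 1 : ℕ) : ℝ≥0∞) * (z : ℝ≥0∞) ^ n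
        ≤ stepWeight d h ^ n * (C * (z : ℝ≥0∞) ^ n) * (z : ℝ≥0∞) ^ n := by gcongr
      _ = _ := by
        rw [mul_pow, ENNReal.coe_mul, mul_pow]; ring

/-- The decay rates of bridges and irreducible bridges exist, and the latter is larger. -/
theorem exists_tendsto_rate_lt [NeZero p] (hh : 0 < h) (hφ : IsPotentialFunction φ)
    (hβ : 0 ≤ β) :
    ∃ μ ν : ℝ, Tendsto (rate (bridgeSum d p h φ β)) atTop (𝓝 μ) ∧
      Tendsto (rate (irreducibleSum d p h φ β)) atTop (𝓝 ν) ∧ μ < ν := by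
  set B := bridgeSum d p h φ β with hB
  set Λ := irreducibleSum d p h φ β with hΛ
  set G := returnSum d p h with hGdef
  have hGtop : G ≠ ∞ := (returnSum_lt_top hh).ne
  have hG : 0 < G.toReal :=
    ENNReal.toReal_pos (one_pos.trans_le one_le_returnSum).ne' hGtop
  have hBtop : ∀ n, B n ≠ ∞ := fun n => (bridgeSum_lt_top hh hφ hβ n).ne
  have hΛtop : ∀ n, Λ n ≠ ∞ := fun n => ne_top_of_le_ne_top (hBtop n)
    (irreducibleSum_le_bridgeSum n)
  have hBpos : ∀ n, 0 < (B n).toReal := fun n =>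
    ENNReal.toReal_pos (bridgeSum_pos hφ hβ n).ne' (hBtop n)
  have hΛpos : ∀ n, 0 < n → 0 < (Λ n).toReal := fun n hn =>
    ENNReal.toReal_pos (irreducibleSum_pos hφ hβ hn).ne' (hΛtop n)
  have hΛB : ∀ n, (Λ n).toReal ≤ (B n).toReal := fun n =>
    ENNReal.toReal_mono (hBtop n) (irreducibleSum_le_bridgeSum n)
  have hgrow : ∀ n, (B n).toReal ≤ G.toReal * (Real.exp h ^ p) ^ n := by
    intro n
    have h1 := ENNReal.toReal_mono (ENNReal.mul_ne_top (by finiteness) hGtop)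
      (bridgeSum_le (d := d) (p := p) (h := h) hφ hβ n)
    rw [ENNReal.toReal_mul, ENNReal.toReal_pow, ENNReal.toReal_ofReal (Real.exp_pos _).le] at h1
    refine h1.trans_eq ?_
    rw [mul_comm h, Real.exp_nat_mul, ← pow_mul, ← pow_mul, mul_comm n p, mul_comm]
  -- existence of the decay rates
  obtain ⟨μ, hμ, hμle⟩ := exists_tendsto_rate (a := B) (c := 1) one_pos hG
    (by positivity : (0 : ℝ) < Real.exp h ^ p) (fun n _ => hBpos n) (fun m n _ _ => by
      rw [one_mul, ← ENNReal.toReal_mul]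
      exact ENNReal.toReal_mono (hBtop _) (bridgeSum_mul_le hφ hβ m n)) fun n _ => hgrow n
  have hdet : (detourWeight d p h φ β) ≠ ∞ := by
    rw [detourWeight, tupleWeight]
    exact ENNReal.prod_ne_top fun _ _ => wordWeight_ne_top _
  obtain ⟨ν, hν, -⟩ := exists_tendsto_rate (a := Λ)
    (ENNReal.toReal_pos (a := detourWeight d p h φ β) (tupleWeight_pos _).ne' hdet) hG
    (by positivity : (0 : ℝ) < Real.exp h ^ p) hΛpos (fun m n _ _ => by
      rw [← ENNReal.toReal_mul, ← ENNReal.toReal_mul]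
      exact ENNReal.toReal_mono (hΛtop _) (irreducibleSum_mul_le hφ hβ m n))
    fun n _ => (hΛB n).trans (hgrow n)
  refine ⟨μ, ν, hμ, hν, ?_⟩
  -- the normalized weights of bridges lie between `1 / G` and `1`
  set x : ℝ≥0∞ := ENNReal.ofReal (Real.exp μ) with hx
  have hxn : ∀ n : ℕ, x ^ n = ENNReal.ofReal (Real.exp (μ * n)) := fun n => by
    rw [hx, ← ENNReal.ofReal_pow (Real.exp_pos _).le, mul_comm μ, Real.exp_nat_mul]
  have hBx : ∀ n, B n * x ^ n ≤ 1 := by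
    intro n
    rcases Nat.eq_zero_or_pos n with rfl | hn
    · rw [pow_zero, mul_one]
      have h1 : B 0 * B 1 ≤ 1 * B 1 := by
        rw [one_mul]; exact (bridgeSum_mul_le hφ hβ 0 1)
      exact (ENNReal.mul_le_mul_iff_left (bridgeSum_pos hφ hβ 1).ne' (hBtop 1)).1 h1
    · have h1 := hμle n hn
      rw [one_mul] at h1
      rw [hxn, ← ENNReal.ofReal_toReal (hBtop n), ← ENNReal.ofReal_mul (hBpos n).le,
        ENNReal.ofReal_le_one]
      calc (B n).toReal * Real.exp (μ * n) ≤ Real.exp (-μ * n) * Real.exp (μ * n) := by gcongr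
        _ = 1 := by rw [← Real.exp_add]; simp
  have hGBx : ∀ n, 1 ≤ G * (B n * x ^ n) := by
    intro n
    rcases Nat.eq_zero_or_pos n with rfl | hn
    · rw [pow_zero, mul_one]
      exact one_le_mul one_le_returnSum (one_le_bridgeSum_zero hφ)
    · have h1 := exp_le_of_tendsto_rate hG hBpos (fun m n => by
        rw [← ENNReal.toReal_mul, ← ENNReal.toReal_mul]
        exact ENNReal.toReal_mono (by finiteness [hBtop m, hBtop n])
          (bridgeSum_add_le hφ hβ m n)) hμ hn
      rw [hxn, ← ENNReal.ofReal_toReal (hBtop n), ← ENNReal.ofReal_mul (hBpos n).le,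
        ← ENNReal.ofReal_toReal hGtop, ← ENNReal.ofReal_mul hG.le, ENNReal.one_le_ofReal]
      calc (1 : ℝ) = Real.exp (-μ * n) * Real.exp (μ * n) := by rw [← Real.exp_add]; simp
        _ ≤ G.toReal * (B n).toReal * Real.exp (μ * n) := by gcongr
        _ = _ := by ring
  -- hence the normalized weights of irreducible bridges are summable
  have hsum : ∑' k, Λ k * x ^ k ≤ G := by
    refine ENNReal.tsum_le_of_sum_range_le fun N => ?_
    calc ∑ k ∈ Finset.range N, Λ k * x ^ k
        ≤ ∑ k ∈ Finset.range (N + 1), Λ k * x ^ k :=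
          Finset.sum_le_sum_of_subset (Finset.range_subset_range.2 N.le_succ)
      _ ≤ ∑ k ∈ Finset.range (N + 1), Λ k * x ^ k * (G * (B (N - k) * x ^ (N - k))) :=
          Finset.sum_le_sum fun k _ => le_mul_of_one_le_right' (hGBx _)
      _ = G * ((∑ k ∈ Finset.range (N + 1), Λ k * B (N - k)) * x ^ N) := by
          rw [Finset.sum_mul, Finset.mul_sum]
          refine Finset.sum_congr rfl fun k hk => ?_
          rw [← pow_mul_pow_sub x (Finset.mem_range_succ_iff.1 hk)]
          ring
      _ ≤ G * (B N * x ^ N) := by gcongr; exact sum_irreducibleSum_mul_le hφ hβ N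
      _ ≤ G * 1 := by gcongr; exact hBx N
      _ = G := mul_one G
  have hsum' : ∑' k, Λ k * x ^ k ≠ ∞ := ne_top_of_le_ne_top hGtop hsum
  -- and their tails decay exponentially
  obtain ⟨z, hz, hmom⟩ := exists_exponential_moment (d := d) (p := p) hh
  obtain ⟨w, hw, A, hA, hdecay⟩ := exists_exponential_decay
    (T := fun n => ∑' k, Λ (k + n) * x ^ (k + n)) hz hmom
    (fun n => ENNReal.tsum_comp_le_tsum_of_injective (add_left_injective n)
      fun k => Λ k * x ^ k) hsum' (ENNReal.tendsto_sum_nat_add (fun k => Λ k * x ^ k) hsum')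
    (fun m n hm hn => tail_add_le hφ hβ hBx hm hn)
  have hwpos : (0 : ℝ) < w := by exact_mod_cast one_pos.trans hw
  have hfin := le_of_tendsto_rate (a := Λ) (μ := μ) (w := w) (A := A.toReal) hwpos hΛpos
    (fun n hn => by
      have h1 : Λ n * x ^ n * (w : ℝ≥0∞) ^ n ≤ A := by
        refine le_trans ?_ (hdecay n)
        gcongr
        exact (ENNReal.le_tsum 0).trans_eq' (by simp)
      have h2 := ENNReal.toReal_mono hA h1
      rwa [ENNReal.toReal_mul, ENNReal.toReal_mul, hxn, ENNReal.toReal_ofReal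
        (Real.exp_pos _).le, ENNReal.toReal_pow] at h2) hν
  have := Real.log_pos (x := w) (by exact_mod_cast hw)
  linarith

end Gap

/-! ### Trajectories of words -/

section Trajectories

variable {d : ℕ}

/-- The trajectory with steps `w`, stopped at its endpoint. -/
def traj (w : List (Step d)) (n : ℕ) : Fin d → ℤ := disp (w.take n)

@[simp] lemma traj_zero (w : List (Step d)) : traj w 0 = 0 := by simp [traj]

lemma traj_length (w : List (Step d)) : traj w w.length = disp w := by simp [traj]

lemma traj_of_length_le {w : List (Step d)} {n : ℕ} (hn : w.length ≤ n) :
    traj w n = disp w := by simp [traj, List.take_of_length_le hn]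

lemma traj_succ (w : List (Step d)) {n : ℕ} (hn : n < w.length) :
    traj w (n + 1) = traj w n + (w[n]).1 := by
  rw [traj, traj, ← List.take_append_getElem hn]
  simp only [disp_append, disp_cons, disp_nil, add_zero]

lemma traj_append_of_le (u v : List (Step d)) {n : ℕ} (hn : n ≤ u.length) :
    traj (u ++ v) n = traj u n := by
  rw [traj, traj, List.take_append_of_le_length hn]

lemma localTime_succ (X : ℕ → Fin d → ℤ) (N : ℕ) (x : Fin d → ℤ) :
    localTime X (N + 1) x = localTime X N x + if X (N + 1) = x then 1 else 0 := by
  unfold localTime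
  rw [← Finset.insert_Icc_right_eq_Icc_add_one (by omega), Finset.filter_insert]
  split_ifs with hx
  · rw [Finset.card_insert_of_notMem (by simp)]
  · rfl

lemma localTime_congr {X X' : ℕ → Fin d → ℤ} {N : ℕ} (hX : ∀ n ≤ N, X n = X' n)
    (x : Fin d → ℤ) : localTime X N x = localTime X' N x := by
  unfold localTime
  congr 1
  refine Finset.filter_congr fun n hn => ?_
  rw [hX n (Finset.mem_Icc.1 hn).2]

lemma localTime_traj (w : List (Step d)) (x : Fin d → ℤ) :
    localTime (traj w) w.length x = (sites w).count x := by
  induction w using List.reverseRecOn with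
  | nil => simp [localTime, sites]
  | append_singleton w s ih =>
    have h1 : localTime (traj (w ++ [s])) w.length x = localTime (traj w) w.length x :=
      localTime_congr (fun n hn => traj_append_of_le w [s] hn) x
    have h2 : traj (w ++ [s]) (w.length + 1) = disp w + s.1 := by
      rw [traj_of_length_le (by simp)]; simp
    rw [List.length_append, List.length_singleton, localTime_succ, h1, ih, h2, sites_append,
      List.count_append]
    simp [sites, List.count_singleton]

lemma pathPotential_traj (φ : ℝ → ℝ) (β : ℝ) (w : List (Step d)) :
    pathPotential φ β (traj w) w.length = sitePotential φ β (sites w) := by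
  simp only [pathPotential, sitePotential, localTime_traj]

lemma pathPotential_congr {φ : ℝ → ℝ} {β : ℝ} {X X' : ℕ → Fin d → ℤ} {N : ℕ}
    (hX : ∀ n ≤ N, X n = X' n) : pathPotential φ β X N = pathPotential φ β X' N := by
  simp only [pathPotential, localTime_congr hX]

/-- Words of the same length with the same trajectory coincide. -/
lemma traj_injective {w w' : List (Step d)} (hlen : w.length = w'.length)
    (h : ∀ n ≤ w.length, traj w n = traj w' n) : w = w' := by
  refine List.ext_getElem hlen fun n hn hn' => Subtype.ext ?_
  have h1 := traj_succ w hn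
  have h2 := traj_succ w' hn'
  rw [h (n + 1) hn, h n hn.le, h2] at h1
  exact (add_left_cancel h1).symm

/-- Every finite nearest-neighbour path started at the origin is the trajectory of a word. -/
lemma exists_traj_eq {n : ℕ} (x : Fin (n + 1) → Fin d → ℤ) (h0 : x 0 = 0)
    (hx : ∀ i : Fin n, ∑ k : Fin d, |x i.succ k - x i.castSucc k| = 1) :
    ∃ w : List (Step d), w.length = n ∧ ∀ i : Fin (n + 1), traj w i = x i := by
  refine ⟨List.ofFn fun i : Fin n => ⟨x i.succ - x i.castSucc, by simpa using hx i⟩, by simp,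
    fun i => ?_⟩
  induction i using Fin.induction with
  | zero => simp [h0]
  | succ i ih =>
    rw [Fin.val_succ, traj_succ _ (by simp)]
    rw [Fin.val_castSucc] at ih
    rw [ih]
    simp

lemma sum_abs_traj_sub (w : List (Step d)) {n : ℕ} (hn : n < w.length) :
    ∑ k : Fin d, |traj w (n + 1) k - traj w n k| = 1 := by
  rw [traj_succ w hn]
  simpa using (w[n]).2

variable [NeZero d]

lemma wordBridge_iff (w : List (Step d)) :
    WordBridge w ↔ ∀ n, 0 < n → n ≤ w.length → 0 < traj w n 0 ∧ traj w n 0 ≤ disp w 0 := by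
  refine ⟨fun hw n hn hnw => ?_, fun hw a b hab => ?_⟩
  · have h1 := hw (w.take n) (w.drop n) (List.take_append_drop n w).symm
    have h2 : ht w = ht (w.take n) + ht (w.drop n) := by
      rw [← ht_append, List.take_append_drop]
    refine ⟨h1.1 ?_, ?_⟩
    · rw [ne_eq, List.take_eq_nil_iff, ← List.length_eq_zero_iff]
      omega
    · change ht (w.take n) ≤ ht w
      omega
  · subst hab
    have key : a ≠ [] → 0 < ht a ∧ ht a ≤ ht (a ++ b) := fun ha => by
      have := hw a.length (List.length_pos_iff.2 ha) (by simp)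
      rwa [traj_append_of_le a b le_rfl, traj_length] at this
    refine ⟨fun ha => (key ha).1, ?_⟩
    by_cases ha : a = []
    · subst ha
      by_cases hb : b = []
      · simp [hb]
      · have := hw b.length (List.length_pos_iff.2 hb) (by simp)
        rw [List.nil_append, traj_length] at this
        exact this.1.le
    · have := (key ha).2
      rw [ht_append] at this
      omega

end Trajectories

/-! ### Bridges of trajectories and of words -/

section BridgeTranslation

variable {d p : ℕ} [NeZero d] [NeZero p]

lemma isBridge_zero_iff {w : Fin p → List (Step d)} {n : Fin p → ℕ}
    (hn : ∀ j, n j ≤ (w j).length) :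
    IsBridge (fun j => traj (w j)) 0 n ↔
      ∀ j, WordBridge ((w j).take (n j)) ∧
        ht ((w j).take (n j)) = ht ((w 0).take (n 0)) := by
  have h1 : ∀ j i, i ≤ n j → traj ((w j).take (n j)) i = traj (w j) i := fun j i hi => by
    rw [traj, List.take_take, min_eq_left hi, traj]
  have h2 : ∀ j, ((w j).take (n j)).length = n j := fun j => by simp [hn j]
  simp only [IsBridge, wordBridge_iff, h2, Pi.zero_apply, traj_zero]
  refine ⟨fun h j => ⟨fun i hi hij => ?_, (h.2 j).2.1⟩, fun h =>
    ⟨fun j => Nat.zero_le _, fun j => ⟨trivial, (h j).2, fun i hi hij => ?_⟩⟩⟩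
  · rw [h1 j i hij]
    exact (h.2 j).2.2 i hi hij
  · rw [← h1 j i hij]
    exact (h j).1 i hi hij

lemma isBridge_length_iff {w : Fin p → List (Step d)} {n : Fin p → ℕ}
    (hn : ∀ j, n j ≤ (w j).length) :
    IsBridge (fun j => traj (w j)) n (fun j => (w j).length) ↔
      ∀ j, WordBridge ((w j).drop (n j)) ∧
        ht ((w j).take (n j)) = ht ((w 0).take (n 0)) ∧ ht (w j) = ht (w 0) := by
  have h1 : ∀ j i, traj (w j) (n j + i) = traj (w j) (n j) + traj ((w j).drop (n j)) i :=
    fun j i => by rw [traj, List.take_add, disp_append]; rfl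
  have h2 : ∀ j, disp (w j) = traj (w j) (n j) + disp ((w j).drop (n j)) := fun j => by
    rw [traj, ← disp_append, List.take_append_drop]
  simp only [IsBridge, wordBridge_iff, traj_length, List.length_drop]
  refine ⟨fun h j => ⟨fun i hi hij => ?_, (h.2 j).1, (h.2 j).2.1⟩, fun h =>
    ⟨hn, fun j => ⟨(h j).2.1, (h j).2.2, fun i hi hij => ?_⟩⟩⟩
  · have := (h.2 j).2.2 (n j + i) (by omega) (by have := hn j; omega)
    rw [h1 j i, h2 j] at this
    simpa using this
  · have := (h j).1 (i - n j) (by omega) (by omega)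
    rw [show i = n j + (i - n j) by omega, h1 j, h2 j]
    simpa using this

lemma isBridge_iff_tupleBridge (w : Fin p → List (Step d)) (L : ℕ) :
    IsBridge (fun j => traj (w j)) 0 (fun j => (w j).length) ∧
      span (fun j => traj (w j)) 0 (fun j => (w j).length) = L ↔ TupleBridge L w := by
  rw [isBridge_zero_iff fun _ => le_rfl]
  simp only [List.take_length, span, Pi.zero_apply, traj_zero, traj_length, sub_zero]
  refine ⟨fun h j => ⟨(h.1 j).1, (h.1 j).2.trans h.2⟩, fun h =>
    ⟨fun j => ⟨(h j).1, ((h j).2).trans ((h 0).2).symm⟩, (h 0).2⟩⟩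

lemma isBreakingPoint_iff {w : Fin p → List (Step d)} {L R : ℕ} (hw : TupleBridge L w) :
    IsBreakingPoint (fun j => traj (w j)) 0 (fun j => (w j).length) R ↔
      0 < R ∧ R ≤ L ∧ ∀ j, BreaksAt (w j) R := by
  simp only [IsBreakingPoint, span, Pi.zero_apply, traj_zero, traj_length, sub_zero]
  rw [show disp (w 0) 0 = L from (hw 0).2]
  constructor
  · rintro ⟨h1, h2, n, hn0, hn, ⟨hb1, hR1⟩, hb2, -⟩
    rw [isBridge_zero_iff hn] at hb1
    rw [isBridge_length_iff hn] at hb2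
    exact ⟨by exact_mod_cast h1, by exact_mod_cast h2, fun j => ⟨(w j).take (n j),
      (w j).drop (n j), (List.take_append_drop _ _).symm, (hb1 j).1, (hb2 j).1,
      (hb1 j).2.trans hR1⟩⟩
  · rintro ⟨h1, h2, hbr⟩
    choose a b hab ha hb hR using hbr
    have hn : ∀ j, (a j).length ≤ (w j).length := fun j => by simp [hab j]
    have htake : ∀ j, (w j).take (a j).length = a j := fun j => by simp [hab j]
    have hdrop : ∀ j, (w j).drop (a j).length = b j := fun j => by simp [hab j]
    refine ⟨by exact_mod_cast h1, by exact_mod_cast h2, fun j => (a j).length, fun j => ?_, hn,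
      ⟨?_, ?_⟩, ?_, ?_⟩
    · refine List.length_pos_iff.2 fun h0 => ?_
      have := hR j
      rw [h0, ht_nil] at this
      omega
    · rw [isBridge_zero_iff hn]
      exact fun j => by rw [htake, htake, hR, hR]; exact ⟨ha j, rfl⟩
    · rw [traj, htake]; exact hR 0
    · rw [isBridge_length_iff hn]
      exact fun j => by
        rw [htake, htake, hdrop, hR, hR, (hw j).2, (hw 0).2]; exact ⟨hb j, rfl, rfl⟩
    · rw [traj, htake, show disp (a 0) 0 = R from hR 0]

lemma isIrreducibleBridge_iff_tupleIrreducible (w : Fin p → List (Step d)) (L : ℕ) :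
    IsIrreducibleBridge (fun j => traj (w j)) 0 (fun j => (w j).length) ∧
      span (fun j => traj (w j)) 0 (fun j => (w j).length) = L ↔ TupleIrreducible L w := by
  have hend : traj (w 0) (w 0).length 0 = ht (w 0) := by rw [traj_length]; rfl
  constructor
  · rintro ⟨⟨hpos, hb, hbr⟩, hspan⟩
    have hw := (isBridge_iff_tupleBridge w L).1 ⟨hb, hspan⟩
    have hL : 0 < L := by
      have h1 := (hw 0).1.ht_pos (a := w 0) (b := []) (by simp)
        (List.length_pos_iff.1 (hpos 0))
      have h2 := (hw 0).2
      omega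
    refine ⟨hL, hw, fun R hR hRL hall => ?_⟩
    have := (hbr R).1 ((isBreakingPoint_iff hw).2 ⟨hR, hRL.le, hall⟩)
    dsimp only at this
    rw [hend, (hw 0).2] at this
    omega
  · rintro ⟨hL, hw, hbr⟩
    obtain ⟨hb, hspan⟩ := (isBridge_iff_tupleBridge w L).2 hw
    refine ⟨⟨fun j => List.length_pos_iff.2 fun h0 => ?_, hb, fun R => ?_⟩, hspan⟩
    · have := (hw j).2
      rw [h0, ht_nil] at this
      omega
    · dsimp only
      rw [hend, (hw 0).2]
      constructor
      · intro hR
        obtain ⟨r, rfl⟩ := Int.eq_ofNat_of_zero_le (a := R)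
          (by have := hR.1; simp at this; exact this.le)
        obtain ⟨h1, h2, h3⟩ := (isBreakingPoint_iff hw).1 hR
        by_contra hne
        exact hbr r h1 (by omega) h3
      · rintro rfl
        exact (isBreakingPoint_iff hw).2 ⟨hL, le_rfl, fun j =>
          ⟨w j, [], by simp, (hw j).1, wordBridge_nil, (hw j).2⟩⟩

lemma IsBridge.congr {X X' : Fin p → ℕ → Fin d → ℤ} {N M n : Fin p → ℕ}
    (hX : ∀ j, ∀ i ≤ N j, X j i = X' j i) (hn : n ≤ N) (h : IsBridge X M n) :
    IsBridge X' M n := by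
  refine ⟨h.1, fun j => ?_⟩
  have hM := fun j => hX j (M j) ((h.1 j).trans (hn j))
  rw [← hM, ← hM, ← hX j _ (hn j), ← hX 0 _ (hn 0)]
  refine ⟨(h.2 j).1, (h.2 j).2.1, fun i hi hij => ?_⟩
  rw [← hX j i (hij.trans (hn j))]
  exact (h.2 j).2.2 i hi hij

lemma span_congr {X X' : Fin p → ℕ → Fin d → ℤ} {N M n : Fin p → ℕ}
    (hX : ∀ j, ∀ i ≤ N j, X j i = X' j i) (hM : M ≤ N) (hn : n ≤ N) :
    span X M n = span X' M n := by
  rw [span, span, hX 0 _ (hn 0), hX 0 _ (hM 0)]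

lemma IsBreakingPoint.congr {X X' : Fin p → ℕ → Fin d → ℤ} {N M : Fin p → ℕ} {R : ℤ}
    (hX : ∀ j, ∀ i ≤ N j, X j i = X' j i) (hM : M ≤ N) (h : IsBreakingPoint X M N R) :
    IsBreakingPoint X' M N R := by
  obtain ⟨h1, h2, n, hn0, hn, ⟨hb1, hs1⟩, hb2, hs2⟩ := h
  rw [span_congr hX hM hn] at hs1
  rw [span_congr hX hn le_rfl] at hs2
  rw [hX 0 _ (hM 0)] at h1 hs1
  rw [hX 0 _ le_rfl] at h2 hs2
  exact ⟨h1, h2, n, hn0, hn, ⟨hb1.congr hX hn, hs1⟩, hb2.congr hX le_rfl, hs2⟩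

lemma IsIrreducibleBridge.congr {X X' : Fin p → ℕ → Fin d → ℤ} {N M : Fin p → ℕ}
    (hX : ∀ j, ∀ i ≤ N j, X j i = X' j i) (h : IsIrreducibleBridge X M N) :
    IsIrreducibleBridge X' M N := by
  obtain ⟨hpos, hb, hbr⟩ := h
  refine ⟨hpos, hb.congr hX le_rfl, fun R => ?_⟩
  rw [← hX 0 _ le_rfl, ← hbr]
  exact ⟨fun h => h.congr (fun j i hi => (hX j i hi).symm) hb.1, fun h => h.congr hX hb.1⟩

end BridgeTranslation

/-! ### From the probability space to sums over words -/

section Transfer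

variable {d p : ℕ}

lemma srwPathProb_traj (w : List (Step d)) {n : ℕ} (hn : w.length = n) :
    srwPathProb n (fun i : Fin (n + 1) => traj w i) = (1 / (2 * (d : ℝ))) ^ n := by
  refine if_pos ⟨by simp, fun i => ?_⟩
  simpa using sum_abs_traj_sub w (n := i) (by omega)

lemma exists_traj_of_srwPathProb_ne_zero {n : ℕ} {x : Fin (n + 1) → Fin d → ℤ}
    (hx : srwPathProb n x ≠ 0) :
    ∃ w : List (Step d), w.length = n ∧ ∀ i : Fin (n + 1), traj w i = x i := by
  unfold srwPathProb at hx
  split_ifs at hx with h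
  · exact exists_traj_eq x h.1 h.2
  · exact absurd rfl hx

/-- Summing over the lengths of the words. -/
lemma tsum_indicator_length_eq (f : (Fin p → List (Step d)) → ℝ≥0∞)
    (A : (Fin p → ℕ) → Set (Fin p → List (Step d))) :
    ∑' N : Fin p → ℕ, ∑' w : Fin p → List (Step d),
        {w | (fun j => (w j).length) = N ∧ w ∈ A N}.indicator f w =
      ∑' w : Fin p → List (Step d), {w | w ∈ A fun j => (w j).length}.indicator f w := by
  classical
  rw [ENNReal.tsum_comm]
  refine tsum_congr fun w => ?_
  rw [tsum_eq_single fun j => (w j).length]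
  · simp [Set.indicator]
  · intro N hN
    exact Set.indicator_of_notMem (fun hw => hN hw.1.symm) _

variable [NeZero d]

lemma driftNormalization_eq (h : ℝ) (n : ℕ) :
    driftNormalization d h n = (stepSum d h / (2 * d)) ^ n := by
  let e : (Fin n → Step d) → Fin (n + 1) → Fin d → ℤ := fun f i => traj (List.ofFn f) i
  have he : Function.Injective e := by
    intro f f' hff'
    refine List.ofFn_injective (traj_injective (by simp) fun i hi => ?_)
    rw [List.length_ofFn] at hi
    exact congrFun hff' ⟨i, by omega⟩
  unfold driftNormalization
  rw [← he.tsum_eq, tsum_fintype, div_pow, stepSum, Fintype.sum_pow, Finset.sum_div]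
  · refine Finset.sum_congr rfl fun f _ => ?_
    rw [srwPathProb_traj _ (by simp), ← Real.exp_sum, ← Finset.mul_sum]
    have h1 : e f (Fin.last n) 0 = ∑ i, (f i).1 0 := by
      simp only [e, Fin.val_last]
      rw [traj_of_length_le (by simp), disp, List.map_ofFn, List.sum_ofFn, Finset.sum_apply]
      rfl
    rw [h1]
    push_cast
    rw [one_div, inv_pow, mul_comm, div_eq_mul_inv]
  · intro x hx
    obtain ⟨w, hw, hwx⟩ := exists_traj_of_srwPathProb_ne_zero (left_ne_zero_of_mul hx)
    subst hw
    exact ⟨w.get, funext fun i => by simp [e, hwx]⟩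

variable {Ω : Type*} [MeasurableSpace Ω] {P : Measure Ω} [IsProbabilityMeasure P] {h : ℝ}
  {S : ℕ → Ω → Fin d → ℤ}

/-- The probability that the walk follows a word is the weight of the word without potential. -/
lemma IsDriftedWalk.measure_word (hS : IsDriftedWalk P h S) (w : List (Step d)) :
    P {ω | ∀ i : Fin (w.length + 1), S i ω = traj w i} =
      ENNReal.ofReal (Real.exp (h * (ht w : ℝ)) * (1 / stepSum d h) ^ w.length) := by
  rw [← ofReal_measureReal, hS.law _ fun i : Fin (w.length + 1) => traj w i,
    srwPathProb_traj w rfl, driftNormalization_eq]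
  have h1 := (stepSum_pos d h).ne'
  have h2 : (d : ℝ) ≠ 0 := NeZero.ne _
  rw [Fin.val_last, traj_length, ← ht]
  rw [mul_comm ((1 / (2 * (d : ℝ))) ^ w.length), mul_div_assoc, ← div_pow,
    show 1 / (2 * (d : ℝ)) / (stepSum d h / (2 * d)) = 1 / stepSum d h by field_simp]

lemma IsDriftedWalk.measure_eq_zero (hS : IsDriftedWalk P h S) {n : ℕ}
    {x : Fin (n + 1) → Fin d → ℤ}
    (hx : ¬ ∃ w : List (Step d), w.length = n ∧ ∀ i : Fin (n + 1), traj w i = x i) :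
    P {ω | ∀ i : Fin (n + 1), S i ω = x i} = 0 := by
  have h0 : srwPathProb n x = 0 := by
    by_contra hne
    exact hx (exists_traj_of_srwPathProb_ne_zero hne)
  rw [← ofReal_measureReal, hS.law, h0]
  simp

/-- The expectation of `exp (-Φ)` on an event that is determined by the trajectories up to the
times `N j` is a sum over words of lengths `N j`. -/
lemma weight_eq_tsum (hS : IsDriftedWalk P h S) (φ : ℝ → ℝ) (β : ℝ) (N : Fin p → ℕ)
    (A : Set (Fin p → ℕ → Fin d → ℤ))
    (hA : ∀ X X' : Fin p → ℕ → Fin d → ℤ, (∀ j, ∀ i ≤ N j, X j i = X' j i) → X ∈ A → X' ∈ A) :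
    weight p P S φ β N A = ∑' w : Fin p → List (Step d),
      {w | (fun j => (w j).length) = N ∧ (fun j => traj (w j)) ∈ A}.indicator
        (tupleWeight h φ β) w := by
  classical
  -- the finite trajectories are random elements of a countable space
  let Y := (j : Fin p) → Fin (N j + 1) → Fin d → ℤ
  let res : (Fin p → Ω) → Y := fun ω j i => S i (ω j)
  let ext : Y → Fin p → ℕ → Fin d → ℤ := fun y j n => y j ⟨min n (N j), by omega⟩
  let g : Y → ℝ≥0∞ := fun y => (ext ⁻¹' A).indicator
    (fun y => ENNReal.ofReal (Real.exp (-pathPotentialTuple φ β (ext y) N))) y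
  have hres : Measurable res := by
    refine measurable_pi_lambda _ fun j => measurable_pi_lambda _ fun i => ?_
    exact (hS.measurable i).comp (measurable_pi_apply j)
  have hext : ∀ ω, ∀ j, ∀ i ≤ N j, copies p S ω j i = ext (res ω) j i := fun ω j i hi => by
    simp [copies, ext, res, min_eq_left hi]
  have hmem : ∀ ω, copies p S ω ∈ A ↔ ext (res ω) ∈ A := fun ω =>
    ⟨hA _ _ (hext ω), hA _ _ fun j i hi => (hext ω j i hi).symm⟩
  have hset : {ω | copies p S ω ∈ A} = res ⁻¹' (ext ⁻¹' A) := Set.ext hmem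
  have hmeas : MeasurableSet (ext ⁻¹' A) := (Set.to_countable _).measurableSet
  have hstep : weight p P S φ β N A =
      ∑' y : Y, g y * ∏ j, P {ω | ∀ i : Fin (N j + 1), S i ω = y j i} := by
    unfold weight
    rw [hset, ← lintegral_indicator (hres hmeas)]
    calc _ = ∫⁻ ω, g (res ω) ∂(Measure.pi fun _ : Fin p => P) := by
          refine lintegral_congr fun ω => ?_
          simp only [g, Set.indicator, Set.mem_preimage]
          split_ifs
          · rw [pathPotentialTuple, pathPotentialTuple,
              Finset.sum_congr rfl fun j _ => pathPotential_congr (hext ω j)]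
          · rfl
      _ = ∫⁻ y, g y ∂((Measure.pi fun _ : Fin p => P).map res) :=
          (lintegral_map (measurable_of_countable g) hres).symm
      _ = _ := by
          rw [lintegral_countable']
          refine tsum_congr fun y => ?_
          rw [Measure.map_apply hres (measurableSet_singleton y), ← Measure.pi_pi]
          congr 2
          ext ω
          rw [Set.mem_preimage, Set.mem_singleton_iff, Set.mem_univ_pi]
          exact ⟨fun hω j i => congrFun (congrFun hω j) i,
            fun hω => funext fun j => funext fun i => hω j i⟩
  rw [hstep]
  -- almost surely the trajectories follow words
  let W := {w : Fin p → List (Step d) // ∀ j, (w j).length = N j}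
  let e : W → Y := fun w j i => traj (w.1 j) i
  have he : Function.Injective e := by
    rintro ⟨w, hw⟩ ⟨w', hw'⟩ hww'
    refine Subtype.ext (funext fun j => traj_injective ((hw j).trans (hw' j).symm)
      fun i hi => ?_)
    rw [hw] at hi
    exact congrFun (congrFun hww' j) ⟨i, by omega⟩
  rw [← he.tsum_eq]
  · refine Eq.trans ?_
      (tsum_subtype_eq_of_support_subset (s := {w | ∀ j, (w j).length = N j}) ?_)
    · refine tsum_congr fun ⟨w, hw⟩ => ?_
      have hw' : ∀ j, (w j).length = N j := hw
      obtain rfl : N = fun j => (w j).length := funext fun j => (hw' j).symm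
      have hextw : ext (e ⟨w, hw⟩) = fun j => traj (w j) := by
        funext j n
        simp only [ext, e]
        rcases le_total n (w j).length with hle | hle
        · rw [min_eq_left hle]
        · rw [min_eq_right hle, traj_length, traj_of_length_le hle]
      have hP : ∀ j, P {ω | ∀ i : Fin ((w j).length + 1), S i ω = e ⟨w, hw⟩ j i} =
          ENNReal.ofReal (Real.exp (h * (ht (w j) : ℝ)) *
            (1 / stepSum d h) ^ (w j).length) := fun j => hS.measure_word (w j)
      simp only [g, Set.indicator, Set.mem_preimage, hextw, hP, Set.mem_ofPred_eq, true_and]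
      split_ifs
      · have hZ := stepSum_pos d h
        rw [pathPotentialTuple, ← Finset.sum_neg_distrib, Real.exp_sum,
          ENNReal.ofReal_prod_of_nonneg fun _ _ => (Real.exp_pos _).le,
          ← Finset.prod_mul_distrib, tupleWeight]
        refine Finset.prod_congr rfl fun j _ => ?_
        rw [wordWeight, ← ENNReal.ofReal_mul (Real.exp_pos _).le, pathPotential_traj, mul_comm]
      · simp
    · intro w hw
      have hw1 := Set.mem_of_indicator_ne_zero hw
      exact fun j => congrFun hw1.1 j
  · intro y hy
    have hy' : ∀ j, P {ω | ∀ i : Fin (N j + 1), S i ω = y j i} ≠ 0 := fun j =>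
      Finset.prod_ne_zero_iff.1 (right_ne_zero_of_mul hy) j (Finset.mem_univ j)
    have hex : ∀ j, ∃ w : List (Step d), w.length = N j ∧
        ∀ i : Fin (N j + 1), traj w i = y j i := fun j => by
      by_contra hne
      exact hy' j (hS.measure_eq_zero hne)
    choose w hw hwy using hex
    exact ⟨⟨w, hw⟩, funext fun j => funext fun i => hwy j i⟩

lemma bridgeWeight_eq_bridgeSum [NeZero p] (hS : IsDriftedWalk P h S) (φ : ℝ → ℝ) (β : ℝ)
    (L : ℕ) : bridgeWeight p P S φ β L = bridgeSum d p h φ β L := by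
  unfold bridgeWeight bridgeSum
  simp_rw [weight_eq_tsum hS φ β _ {X | IsBridge X 0 _ ∧ span X 0 _ = (L : ℤ)}
    fun X X' hX hXA => ⟨hXA.1.congr hX le_rfl,
      (span_congr hX (fun _ => Nat.zero_le _) le_rfl).symm.trans hXA.2⟩]
  refine (tsum_indicator_length_eq (tupleWeight h φ β) fun N =>
    {w | (fun j => traj (w j)) ∈ {X | IsBridge X 0 N ∧ span X 0 N = (L : ℤ)}}).trans ?_
  simp only [Set.mem_ofPred_eq, isBridge_iff_tupleBridge]

lemma irreducibleBridgeWeight_eq_irreducibleSum [NeZero p] (hS : IsDriftedWalk P h S)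
    (φ : ℝ → ℝ) (β : ℝ) (L : ℕ) :
    irreducibleBridgeWeight p P S φ β L = irreducibleSum d p h φ β L := by
  unfold irreducibleBridgeWeight irreducibleSum
  simp_rw [weight_eq_tsum hS φ β _ {X | IsIrreducibleBridge X 0 _ ∧ span X 0 _ = (L : ℤ)}
    fun X X' hX hXA => ⟨hXA.1.congr hX,
      (span_congr hX (fun _ => Nat.zero_le _) le_rfl).symm.trans hXA.2⟩]
  refine (tsum_indicator_length_eq (tupleWeight h φ β) fun N =>
    {w | (fun j => traj (w j)) ∈ {X | IsIrreducibleBridge X 0 N ∧ span X 0 N = (L : ℤ)}}).trans ?_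
  simp only [Set.mem_ofPred_eq, isIrreducibleBridge_iff_tupleIrreducible]

end Transfer

end DriftWalk

end

theorem theorem2p18 {d p : ℕ} [NeZero d] [NeZero p]
    {Ω : Type*} [MeasurableSpace Ω] (P : Measure Ω) [IsProbabilityMeasure P]
    (h : ℝ) (hh : 0 < h) (S : ℕ → Ω → Fin d → ℤ) (hS : DriftWalk.IsDriftedWalk P h S)
    (φ : ℝ → ℝ) (hφ : DriftWalk.IsPotentialFunction φ) (β : ℝ) (hβ : 0 ≤ β) :
    (∀ L : ℕ, 1 ≤ L →
      (0 < DriftWalk.bridgeWeight p P S φ β L ∧ DriftWalk.bridgeWeight p P S φ β L < ∞) ∧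
      (0 < DriftWalk.irreducibleBridgeWeight p P S φ β L ∧
        DriftWalk.irreducibleBridgeWeight p P S φ β L < ∞)) ∧
    Tendsto (DriftWalk.rate (DriftWalk.bridgeWeight p P S φ β)) atTop
      (𝓝 (DriftWalk.mass (DriftWalk.bridgeWeight p P S φ β))) ∧
    Tendsto (DriftWalk.rate (DriftWalk.irreducibleBridgeWeight p P S φ β)) atTop
      (𝓝 (DriftWalk.mass (DriftWalk.irreducibleBridgeWeight p P S φ β))) ∧
    DriftWalk.mass (DriftWalk.irreducibleBridgeWeight p P S φ β) >
      DriftWalk.mass (DriftWalk.bridgeWeight p P S φ β) := by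
  have hB := funext (DriftWalk.bridgeWeight_eq_bridgeSum (p := p) hS φ β)
  have hΛ := funext (DriftWalk.irreducibleBridgeWeight_eq_irreducibleSum (p := p) hS φ β)
  rw [hB, hΛ]
  obtain ⟨μ, ν, hμ, hν, hlt⟩ := DriftWalk.exists_tendsto_rate_lt (d := d) (p := p) hh hφ hβ
  have hfin := DriftWalk.bridgeSum_lt_top (d := d) (p := p) hh hφ hβ
  refine ⟨fun L hL => ⟨⟨DriftWalk.bridgeSum_pos hφ hβ L, hfin L⟩,
    DriftWalk.irreducibleSum_pos hφ hβ hL,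
    (DriftWalk.irreducibleSum_le_bridgeSum L).trans_lt (hfin L)⟩, ?_, ?_, ?_⟩
  · rwa [DriftWalk.mass, hμ.limUnder_eq]
  · rwa [DriftWalk.mass, hν.limUnder_eq]
  · rwa [DriftWalk.mass, DriftWalk.mass, hμ.limUnder_eq, hν.limUnder_eq]
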